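/- Let $\Omega\subset\mathbb R^3$ be a bounded Lipschitz domain with a geometrically conforming mesh $\mathcal T$ of tetrahedra, let $k\ge 0$, $\Delta t>0$, $f\in L^2(\Omega)^3$, $p_0\in L^2(\Omega)$, and choose for every $T\in\mathcal T$ a face $F^\star_T$ of $T$. Let $W$, $V$, $Q$ be the spaces of functions that on every $T\in\mathcal T$ belong to $[\mathcal P_k(T)]^{3\times3}$, $[\mathcal P_k(T)]^3$, $\mathcal P_k(T)$, respectively (without continuity between cells), and let $M$ be the space of functions on the mesh skeleton that belong to $[\mathcal P_k(F)]^3$ on every face $F$ and vanish on the faces in $\partial\Omega$. Write $(\cdot,\cdot)$ for the $L^2(\Omega)$ inner product, with derivatives taken cell by cell, $\langle\!\langle a,b\rangle\!\rangle=\sum_{T\in\mathcal T}\int_{\partial T}a\cdot b\,d\sigma$, and $\nu$ for the outward unit normal of $T$ on $\partial T$. For a number $\tau^\star>0$ let $S=\tau\,\mathrm{Id}$, where on $\partial T$ one sets $\tau=\tau^\star$ on $F^\star_T$ and $\tau=0$ on $\partial T\setminus F_T^\star$. The iterates of the augmented Lagrangian single face hybridizable (SFH) method are defined as follows: $p^0\in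 Q$ is the $L^2$ projection of $p_0$, and for $n\ge1$, $(L^n,u^n,p^n,\lambda^n)\in W\times V\times Q\times M$ satisfies $$(L^n,G)+(u^n,\nabla\cdot G)-\langle\!\langle\lambda^n,G\nu\rangle\!\rangle=0,$$ $$(-\nabla\cdot L^n+\nabla p^n,v)+\langle\!\langle S(u^n-\lambda^n),v\rangle\!\rangle=(f,v),$$ $$\tfrac1{\Delta t}(p^n,q)-(u^n,\nabla q)+\langle\!\langle\lambda^n\cdot\nu,q\rangle\!\rangle=\tfrac1{\Delta t}(p^{n-1},q),$$ $$\langle\!\langle -L^n\nu+p^n\nu+S(u^n-\lambda^n),\mu\rangle\!\rangle=0$$ for all $(G,v,q,\mu)\in W\times V\times Q\times M$. Then for every $\tau^\star>0$ the iterates exist and are unique for all $n\ge1$, and $\lambda^n$, $p^n$ and $L^n$ do not depend on the choice of $\tau^\star$. The velocity $u^n$ in general does depend on $\tau^\star$: for any $\tau_1^\star\ne\tau_2^\star$ and any $n\ge1$, the corresponding velocities $u^n$ coincide if and only if on every cell $T$ the function $f$ is $L^2(T)$-orthogonal to all $v\in[\mathcal P_k(T)]^3$ that are $L^2(T)$-orthogonal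 to $[\mathcal P_{k-1}(T)]^3$ (with $\mathcal P_{-1}=\{0\}$), and there are $f\in L^2(\Omega)^3$ for which this condition fails. -/

import Mathlib

open MeasureTheory

noncomputable section

namespace StokesHDG

/-- Points (and vectors) of Euclidean three-space. -/
abbrev Pt : Type := EuclideanSpace ℝ (Fin 3)

/-- Real polynomial functions in the three space variables. -/
abbrev Poly : Type := MvPolynomial (Fin 3) ℝ

/-- The value of a polynomial at a point. -/
def ev (q : Poly) (x : Pt) : ℝ := MvPolynomial.eval (fun i => x i) q

/-- The polynomials of total degree at most `k`. -/
abbrev P (k : ℕ) : Submodule ℝ Poly := MvPolynomial.restrictTotalDegree (Fin 3) ℝ k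

/-- The partial derivative with respect to the `j`-th variable. -/
abbrev dd (j : Fin 3) (q : Poly) : Poly := MvPolynomial.pderiv j q

/-- A geometrically conforming tetrahedral mesh of `Ω`: a finite geometric simplicial complex,
each simplex of which is a face of a tetrahedron, and which fills the closure of `Ω`. -/
structure Mesh (Ω : Set Pt) extends Geometry.SimplicialComplex ℝ Pt where
  finite_faces : toSimplicialComplex.faces.Finite
  pure : ∀ s ∈ toSimplicialComplex.faces,
    ∃ T ∈ toSimplicialComplex.faces, s ⊆ T ∧ T.card = 4
  space_eq : toSimplicialComplex.space = closure Ω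

/-- The solid simplex with the given vertices. -/
abbrev hull (s : Finset Pt) : Set Pt := convexHull ℝ (s : Set Pt)

/-- The unit normal to the triangle `F`, outward with respect to a tetrahedron `T` that has `F` as
a face: the normalized component, orthogonal to `F`, of the vector from the centroid of `T` to the
centroid of `F`. -/
def normal (T F : Finset Pt) : Pt :=
  NormedSpace.normalize ((vectorSpan ℝ (F : Set Pt))ᗮ.starProjection
    (F.centroid ℝ id - T.centroid ℝ id))

/-- The `L²` inner product on a tetrahedron of two (scalar, vector or matrix valued) functions,
given by their families of components. -/
def cellInner {ι : Type} [Fintype ι] (T : Finset Pt) (a b : ι → Pt → ℝ) : ℝ :=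
  ∫ x in hull T, ∑ i, a i x * b i x

namespace Mesh

variable {Ω : Set Pt} (M : Mesh Ω)

/-- The tetrahedra of the mesh. -/
def cells : Finset (Finset Pt) := M.finite_faces.toFinset.filter (fun s => s.card = 4)

/-- The triangular faces of the mesh. -/
def facets : Finset (Finset Pt) := M.finite_faces.toFinset.filter (fun s => s.card = 3)

open Classical in
/-- The triangular faces of the cell `T`, whose union is the boundary of `T`. -/
def facetsOf (T : M.cells) : Finset M.facets :=
  Finset.univ.filter (fun F => (F : Finset Pt) ⊆ (T : Finset Pt))

/-- Boundary (Dirichlet) faces: those which belong to exactly one cell. -/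
def IsBoundary (F : M.facets) : Prop := ∃! T : M.cells, F ∈ M.facetsOf T

/-- Piecewise polynomial matrix fields, given cell by cell (with no continuity
between cells); a polynomial is determined by its restriction to a cell. -/
abbrev MatField : Type := M.cells → Fin 3 → Fin 3 → Poly

/-- Piecewise polynomial vector fields. -/
abbrev VecField : Type := M.cells → Fin 3 → Poly

/-- Piecewise polynomial scalar fields. -/
abbrev ScalField : Type := M.cells → Poly

/-- Vector valued functions on the skeleton, given face by face; only the values of the `F`-th
function on the triangle `F` are meaningful. -/
abbrev SkelField : Type := M.facets → Pt → Fin 3 → ℝ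

/-- The approximation space of the velocity gradient: piecewise `[P_k(T)]^{3×3}`. -/
def W (k : ℕ) : Set M.MatField := {G | ∀ T i j, G T i j ∈ P k}

/-- The approximation space of the velocity: piecewise `[P_k(T)]^3`. -/
def V (k : ℕ) : Set M.VecField := {v | ∀ T i, v T i ∈ P k}

/-- The approximation space of the pressure: piecewise `P_k(T)`. -/
def Q (k : ℕ) : Set M.ScalField := {q | ∀ T, q T ∈ P k}

/-- The skeleton space: on each face the restriction of a vector polynomial of degree at most `k`,
and zero on the boundary faces. -/
def Tr (k : ℕ) : Set M.SkelField :=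
  {lam | ∀ F : M.facets,
    (∃ g : Fin 3 → Poly, (∀ i, g i ∈ P k) ∧ ∀ x ∈ hull F, ∀ i, lam F x i = ev (g i) x) ∧
    (M.IsBoundary F → ∀ x ∈ hull F, lam F x = 0)}

/-- `(L, G)` for matrix fields. -/
def innerW (L G : M.MatField) : ℝ :=
  ∑ T : M.cells, cellInner T (fun ij : Fin 3 × Fin 3 => ev (L T ij.1 ij.2)) (fun ij => ev (G T ij.1 ij.2))

/-- `(u, v)` for vector fields. -/
def innerV (u v : M.VecField) : ℝ :=
  ∑ T : M.cells, cellInner T (fun i => ev (u T i)) (fun i => ev (v T i))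

/-- `(p, q)` for scalar fields. -/
def innerQ (p q : M.ScalField) : ℝ :=
  ∑ T : M.cells, cellInner T (fun _ : Unit => ev (p T)) (fun _ => ev (q T))

/-- `(f, v)` for a general vector function `f`. -/
def load (f : Pt → Pt) (v : M.VecField) : ℝ :=
  ∑ T : M.cells, cellInner T (fun i x => f x i) (fun i => ev (v T i))

/-- `(p₀, q)` for a general scalar function `p₀`. -/
def loadQ (p₀ : Pt → ℝ) (q : M.ScalField) : ℝ :=
  ∑ T : M.cells, cellInner T (fun _ : Unit => p₀) (fun _ => ev (q T))

/-- The row-wise divergence of a matrix field. -/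
def divW (G : M.MatField) : M.VecField := fun T i => ∑ j, dd j (G T i j)

/-- The gradient of a scalar field. -/
def gradQ (q : M.ScalField) : M.VecField := fun T i => dd i (q T)

/-- `⟪a, b⟫`, the sum over all cells of the integral of `a · b` over the boundary of the cell with
respect to surface measure; `a` and `b` are vector functions on the faces of each cell. -/
def bdInner (a b : M.cells → M.facets → Pt → Fin 3 → ℝ) : ℝ :=
  ∑ T : M.cells, ∑ F ∈ M.facetsOf T, ∫ x in hull F, ∑ i, a T F x i * b T F x i ∂μHE[2]

/-- A skeleton function on the boundaries of the cells (the same on both sides of a face). -/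
def ofSkel (lam : M.SkelField) : M.cells → M.facets → Pt → Fin 3 → ℝ := fun _ F x => lam F x

/-- The trace of a vector field on the boundaries of the cells. -/
def trV (v : M.VecField) : M.cells → M.facets → Pt → Fin 3 → ℝ := fun T _ x i => ev (v T i) x

/-- `G ν` on the boundaries of the cells. -/
def trW (G : M.MatField) : M.cells → M.facets → Pt → Fin 3 → ℝ :=
  fun T F x i => ∑ j, ev (G T i j) x * normal T F j

/-- `q ν` on the boundaries of the cells. -/
def trQ (q : M.ScalField) : M.cells → M.facets → Pt → Fin 3 → ℝ :=
  fun T F x i => ev (q T) x * normal T F i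

/-- A choice of one distinguished face of every cell. -/
structure StarChoice where
  face : M.cells → M.facets
  mem : ∀ T, face T ∈ M.facetsOf T

variable {M}

open Classical in
/-- `S (u - λ)` on the boundaries of the cells: on the boundary of `T`, the stabilization is `τ` times
the identity on the distinguished face of `T` and zero on the other faces of `T`. -/
def stab (star : M.StarChoice) (τ : ℝ) (u : M.VecField) (lam : M.SkelField) :
    M.cells → M.facets → Pt → Fin 3 → ℝ :=
  fun T F x i => (if F = star.face T then τ else 0) * (ev (u T i) x - lam F x i)

/-- One step of the augmented Lagrangian SFH scheme: `(L, u, p, λ)` is a discrete solution for the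
time step size `dt`, right-hand side `f` and pressure `pOld` of the previous step. -/
structure SolvesStep (star : M.StarChoice) (k : ℕ) (τ dt : ℝ) (f : Pt → Pt) (pOld : M.ScalField)
    (L : M.MatField) (u : M.VecField) (p : M.ScalField) (lam : M.SkelField) : Prop where
  L_mem : L ∈ M.W k
  u_mem : u ∈ M.V k
  p_mem : p ∈ M.Q k
  lam_mem : lam ∈ M.Tr k
  eq_gradient : ∀ G ∈ M.W k,
    M.innerW L G + M.innerV u (M.divW G) - M.bdInner (M.ofSkel lam) (M.trW G) = 0
  eq_momentum : ∀ v ∈ M.V k,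
    M.innerV (-M.divW L + M.gradQ p) v + M.bdInner (stab star τ u lam) (M.trV v) = M.load f v
  eq_pressure : ∀ q ∈ M.Q k,
    1 / dt * M.innerQ p q - M.innerV u (M.gradQ q) + M.bdInner (M.ofSkel lam) (M.trQ q)
      = 1 / dt * M.innerQ pOld q
  eq_flux : ∀ mu ∈ M.Tr k,
    M.bdInner (-M.trW L + M.trQ p + stab star τ u lam) (M.ofSkel mu) = 0

/-- `p n`, `n ≥ 0`, and `L n`, `u n`, `lam n`, `n ≥ 1`, are the iterates of the augmented Lagrangian
SFH scheme; `p 0` is the `L²` projection of `p₀`. The values `L 0`, `u 0`, `lam 0` have no meaning. -/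
structure IsIteration (star : M.StarChoice) (k : ℕ) (τ dt : ℝ) (f : Pt → Pt) (p₀ : Pt → ℝ)
    (L : ℕ → M.MatField) (u : ℕ → M.VecField) (p : ℕ → M.ScalField) (lam : ℕ → M.SkelField) :
    Prop where
  init_mem : p 0 ∈ M.Q k
  init_eq : ∀ q ∈ M.Q k, M.innerQ (p 0) q = M.loadQ p₀ q
  step : ∀ n, SolvesStep star k τ dt f (p n) (L (n + 1)) (u (n + 1)) (p (n + 1)) (lam (n + 1))

variable (M) in
/-- On every cell `T`, `f` is `L²`-orthogonal to all `v ∈ [P_k(T)]^3` which are themselves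
`L²`-orthogonal to `[P_{k-1}(T)]^3` (where `P_{-1} = {0}`). Equivalently, on every cell the `L²`
projection of `f` onto `[P_k(T)]^3` belongs to `[P_{k-1}(T)]^3`. -/
def NoTopDegree (k : ℕ) (f : Pt → Pt) : Prop :=
  ∀ T : M.cells, ∀ v : Fin 3 → Poly, (∀ i, v i ∈ P k) →
    (∀ w : Fin 3 → Poly, (∀ i, (w i).totalDegree < k) →
      cellInner T (fun i => ev (v i)) (fun i => ev (w i)) = 0) →
    cellInner T (fun i x => f x i) (fun i => ev (v i)) = 0

end Mesh

end StokesHDG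

end

/-!
Testing the homogeneous scheme with its own solution gives the energy identity
`‖L‖² + ‖p‖² / Δt + τ ∑ ‖u - λ‖²_{F*} = 0`, so `L = 0`, `p = 0` and `u = λ` on the distinguished
faces. The gradient equation then says that the weak gradient of `(u, λ)` vanishes on each cell;
together with `u = λ` on a single face of the cell, this forces `u` to be constant on the cell and
equal to `λ` on all of its faces. Hence `u` is continuous across the interior faces and vanishes on
the boundary, and the divergence theorem applied to `∂₀ (x₀ u²) = u²` yields `u = 0`. The scheme
is a square linear system, so it is uniquely solvable.

A polynomial on a face has a unique lift to a polynomial of the same degree on the cell that is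
orthogonal to all polynomials of lower degree. Adding to `u` the lift of a multiple of `u - λ` from
the distinguished faces therefore changes `τ` into any other parameter while `L`, `p` and `λ` stay
the same. Testing the momentum equation with such lifts shows that `u` itself solves the problem
for two parameters exactly when `f` is orthogonal to all of them.
-/

namespace StokesHDG

open scoped InnerProductSpace

section LinearAlgebra

variable {K X : Type*} [Field K] [AddCommGroup X] [Module K X] [FiniteDimensional K X]

theorem exists_forall_apply_eq_of_ker (B : X →ₗ[K] X →ₗ[K] K) (ℓ : X →ₗ[K] K)
    (hB : ∀ x ∈ LinearMap.ker B, ∀ y, B y x = 0) (hℓ : ∀ x ∈ LinearMap.ker B, ℓ x = 0) :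
    ∃ x, ∀ y, B x y = ℓ y := by
  have range_le : LinearMap.range B ≤ (LinearMap.ker B).dualAnnihilator := by
    rintro _ ⟨x, rfl⟩
    exact (Submodule.mem_dualAnnihilator _).2 fun y hy => hB y hy x
  have range_eq : LinearMap.range B = (LinearMap.ker B).dualAnnihilator := by
    refine Submodule.eq_of_le_of_finrank_eq range_le ?_
    have := B.finrank_range_add_finrank_ker
    have := Subspace.finrank_add_finrank_dualAnnihilator_eq (LinearMap.ker B)
    lia
  have hmem : ℓ ∈ LinearMap.range B := range_eq ▸ (Submodule.mem_dualAnnihilator ℓ).2 hℓ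
  exact hmem.imp fun x hx y => by rw [hx]

theorem exists_forall_apply_eq_of_definite (B : X →ₗ[K] X →ₗ[K] K) (ℓ : X →ₗ[K] K)
    (hB : ∀ x, B x x = 0 → x = 0) : ∃ x, ∀ y, B x y = ℓ y := by
  have ker_eq : ∀ x ∈ LinearMap.ker B, x = 0 := fun x hx =>
    hB x (by rw [LinearMap.mem_ker.1 hx, LinearMap.zero_apply])
  exact exists_forall_apply_eq_of_ker B ℓ (fun x hx y => by rw [ker_eq x hx, map_zero])
    fun x hx => by rw [ker_eq x hx, map_zero]

end LinearAlgebra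

section Cone

variable {E : Type*} [NormedAddCommGroup E] [InnerProductSpace ℝ E]

/-- The slice of `C` at height `s` over the point `a` in the direction `n`, as a subset of the
hyperplane orthogonal to `n`. -/
def slice (a n : E) (C : Set E) (s : ℝ) : Set (ℝ ∙ n)ᗮ := {z | a + (s • n + (z : E)) ∈ C}

theorem inner_orthogonal_span_singleton (n : E) (z : (ℝ ∙ n)ᗮ) : ⟪n, (z : E)⟫_ℝ = 0 :=
  Submodule.mem_orthogonal_singleton_iff_inner_right.1 z.2

theorem isometry_const_add_orthogonal (b n : E) : Isometry fun z : (ℝ ∙ n)ᗮ => b + (z : E) :=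
  (isometry_add_left b).comp isometry_subtype_coe

theorem isCompact_slice [FiniteDimensional ℝ E] {C : Set E} (hC : IsCompact C) (a n : E) (s : ℝ) :
    IsCompact (slice a n C s) := by
  simp only [slice, ← add_assoc]
  exact (isometry_const_add_orthogonal (a + s • n) n).isClosedEmbedding.isCompact_preimage hC

theorem isCompact_convexJoin_singleton (a : E) {K : Set E} (hK : IsCompact K) :
    IsCompact (convexJoin ℝ {a} K) := by
  have himage :
      convexJoin ℝ {a} K = (fun p : ℝ × E => a + p.1 • (p.2 - a)) '' Set.Icc 0 1 ×ˢ K := by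
    ext x
    simp only [convexJoin_singleton_left, segment_eq_image', Set.mem_iUnion, Set.mem_image,
      Set.mem_prod, Prod.exists, exists_prop]
    aesop
  rw [himage]
  exact (isCompact_Icc.prod hK).image (by fun_prop)

variable {a n : E} {h : ℝ} {K : Set E}

theorem exists_mem_Icc_of_mem_slice_convexJoin (hn : ‖n‖ = 1) (hK : ∀ y ∈ K, ⟪n, y - a⟫_ℝ = h)
    {s : ℝ} {z : (ℝ ∙ n)ᗮ} (hz : z ∈ slice a n (convexJoin ℝ {a} K) s) :
    ∃ r ∈ Set.Icc (0 : ℝ) 1, s = r * h ∧ ∃ y ∈ K, r • (y - a) = s • n + (z : E) := by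
  simp only [slice, Set.mem_ofPred_eq, convexJoin_singleton_left, Set.mem_iUnion,
    segment_eq_image', Set.mem_image, exists_prop] at hz
  obtain ⟨y, hy, r, hr, hrz⟩ := hz
  have hrz' : r • (y - a) = s • n + (z : E) := add_left_cancel hrz
  refine ⟨r, hr, ?_, y, hy, hrz'⟩
  have := congrArg (inner ℝ n) hrz'
  rw [inner_smul_right, hK y hy, inner_add_right, inner_smul_right, real_inner_self_eq_norm_sq, hn,
    inner_orthogonal_span_singleton] at this
  linarith

theorem slice_convexJoin_of_notMem (hn : ‖n‖ = 1) (hh : 0 ≤ h) (hK : ∀ y ∈ K, ⟪n, y - a⟫_ℝ = h)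
    {s : ℝ} (hs : s ∉ Set.Icc 0 h) : slice a n (convexJoin ℝ {a} K) s = ∅ := by
  refine Set.eq_empty_of_forall_notMem fun z hz => hs ?_
  obtain ⟨r, hr, rfl, -⟩ := exists_mem_Icc_of_mem_slice_convexJoin hn hK hz
  exact ⟨mul_nonneg hr.1 hh, mul_le_of_le_one_left hh hr.2⟩

open scoped Pointwise in
theorem slice_convexJoin (hn : ‖n‖ = 1) (hh : 0 < h) (hK : ∀ y ∈ K, ⟪n, y - a⟫_ℝ = h)
    {s : ℝ} (hs : s ∈ Set.Ioc 0 h) :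
    slice a n (convexJoin ℝ {a} K) s = (s / h) • slice a n K h := by
  have hsh : s / h ≠ 0 := (div_pos hs.1 hh).ne'
  ext z
  rw [Set.mem_smul_set_iff_inv_smul_mem₀ hsh]
  refine ⟨fun hz => ?_, fun hz => ?_⟩
  · obtain ⟨r, -, rfl, y, hy, hrz⟩ := exists_mem_Icc_of_mem_slice_convexJoin hn hK hz
    have hrh : r * h / h = r := mul_div_cancel_right₀ r hh.ne'
    rw [hrh] at hsh ⊢
    have hyz : a + (h • n + (r⁻¹ • (z : E))) = y := by
      rw [← inv_smul_smul₀ hsh (h • n), ← smul_add, smul_smul, ← hrz, inv_smul_smul₀ hsh,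
        add_sub_cancel]
    simpa only [slice, Set.mem_ofPred_eq, Submodule.coe_smul, hyz] using hy
  · simp only [slice, Set.mem_ofPred_eq, convexJoin_singleton_left, Set.mem_iUnion,
      segment_eq_image', Set.mem_image, exists_prop]
    refine ⟨_, hz, s / h, ⟨(div_pos hs.1 hh).le, (div_le_one hh).2 hs.2⟩, ?_⟩
    rw [Submodule.coe_smul, add_sub_cancel_left, smul_add, smul_inv_smul₀ hsh, smul_smul,
      div_mul_cancel₀ _ hh.ne']

variable [FiniteDimensional ℝ E] [MeasurableSpace E] [BorelSpace E]

open scoped Pointwise in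
theorem setIntegral_slice_convexJoin {d : ℕ} (hd : Module.finrank ℝ E = d + 1) (hn : ‖n‖ = 1)
    (hh : 0 < h) (hK : ∀ y ∈ K, ⟪n, y - a⟫_ℝ = h) {s : ℝ} (hs : s ∈ Set.Ioc 0 h) (g : E → ℝ) :
    ∫ z in slice a n (convexJoin ℝ {a} K) s, g (a + (s • n + (z : E))) =
      (s / h) ^ d * ∫ z in slice a n K h, g (a + (s / h) • (h • n + (z : E))) := by
  have : Fact (Module.finrank ℝ E = d + 1) := ⟨hd⟩
  have hsh : 0 < s / h := div_pos hs.1 hh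
  have hscale := Measure.setIntegral_comp_smul_of_pos (volume : Measure (ℝ ∙ n)ᗮ)
    (fun z : (ℝ ∙ n)ᗮ => g (a + (s • n + (z : E)))) (slice a n K h) hsh
  rw [Submodule.finrank_orthogonal_span_singleton (n := d) (norm_ne_zero_iff.1 (hn ▸ one_ne_zero)),
    smul_eq_mul, eq_inv_mul_iff_mul_eq₀ (by positivity)] at hscale
  rw [slice_convexJoin hn hh hK hs, ← hscale]
  simp only [smul_add, smul_smul, div_mul_cancel₀ _ hh.ne', Submodule.coe_smul]

theorem restrict_hyperplane {d : ℕ} (hd : Module.finrank ℝ E = d + 1) (hn : ‖n‖ = 1)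
    (hK : ∀ y ∈ K, ⟪n, y - a⟫_ℝ = h) :
    (μHE[d] : Measure E).restrict K =
      (volume.restrict (slice a n K h)).map fun z : (ℝ ∙ n)ᗮ => a + (h • n + (z : E)) := by
  have : Fact (Module.finrank ℝ E = d + 1) := ⟨hd⟩
  have hφ := isometry_const_add_orthogonal (a + h • n) n
  have hvol : (μHE[d] : Measure (ℝ ∙ n)ᗮ) = volume := by
    rw [← InnerProductSpace.euclideanHausdorffMeasure_eq_volume,
      Submodule.finrank_orthogonal_span_singleton (n := d) (norm_ne_zero_iff.1 (hn ▸ one_ne_zero))]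
  have hsub : K ⊆ Set.range fun z : (ℝ ∙ n)ᗮ => a + h • n + (z : E) := fun y hy =>
    ⟨⟨y - (a + h • n), Submodule.mem_orthogonal_singleton_iff_inner_right.2 (by
      rw [← sub_sub, inner_sub_right, hK y hy, inner_smul_right, real_inner_self_eq_norm_sq, hn]
      ring)⟩, by simp⟩
  rw [← Measure.restrict_restrict_of_subset hsub, ← hφ.map_euclideanHausdorffMeasure,
    hφ.isClosedEmbedding.measurableEmbedding.restrict_map, hvol]
  simp only [slice, ← add_assoc]
  rfl

theorem measurableEmbedding_slice (a n : E) (s : ℝ) :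
    MeasurableEmbedding fun z : (ℝ ∙ n)ᗮ => a + (s • n + (z : E)) := by
  simpa only [← add_assoc] using
    (isometry_const_add_orthogonal (a + s • n) n).isClosedEmbedding.measurableEmbedding

theorem setIntegral_hyperplane {d : ℕ} (hd : Module.finrank ℝ E = d + 1) (hn : ‖n‖ = 1)
    (hK : ∀ y ∈ K, ⟪n, y - a⟫_ℝ = h) (g : E → ℝ) :
    ∫ y in K, g y ∂μHE[d] = ∫ z in slice a n K h, g (a + (h • n + (z : E))) := by
  rw [restrict_hyperplane hd hn hK, (measurableEmbedding_slice a n h).integral_map]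

theorem integrableOn_hyperplane {d : ℕ} (hd : Module.finrank ℝ E = d + 1) (hn : ‖n‖ = 1)
    (hKc : IsCompact K) (hK : ∀ y ∈ K, ⟪n, y - a⟫_ℝ = h) {g : E → ℝ} (hg : Continuous g) :
    IntegrableOn g K μHE[d] := by
  rw [IntegrableOn, restrict_hyperplane hd hn hK,
    (measurableEmbedding_slice a n h).integrable_map_iff]
  exact (Continuous.continuousOn (by fun_prop)).integrableOn_compact (isCompact_slice hKc a n h)

/-- Cylindrical coordinates with origin `a` and axis the unit vector `n`. -/
noncomputable def cylindricalEquiv (a n : E) (hn : ‖n‖ = 1) : ℝ × (ℝ ∙ n)ᗮ ≃ᵐ E :=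
  ((LinearIsometryEquiv.toSpanUnitSingleton n hn).toHomeomorph.toMeasurableEquiv.prodCongr
    (MeasurableEquiv.refl _)).trans ((ℝ ∙ n).measurableEquivProd a).symm

theorem cylindricalEquiv_apply (hn : ‖n‖ = 1) (x : ℝ × (ℝ ∙ n)ᗮ) :
    cylindricalEquiv a n hn x = a + (x.1 • n + (x.2 : E)) := by
  rw [cylindricalEquiv, MeasurableEquiv.trans_apply, Submodule.measurableEquivProd_symm_apply,
    vadd_eq_add, add_comm]
  rfl

theorem measurePreserving_cylindricalEquiv (hn : ‖n‖ = 1) :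
    MeasurePreserving (cylindricalEquiv a n hn) := by
  have hprod := ((ℝ ∙ n).measurePreserving_measurableEquivProd a).symm
  rw [InnerProductSpace.euclideanHausdorffMeasure_eq_volume] at hprod
  exact ((LinearIsometryEquiv.toSpanUnitSingleton n hn).measurePreserving.prod
    (MeasurePreserving.id _)).trans hprod

theorem setIntegral_eq_integral_slice (hn : ‖n‖ = 1) {C : Set E} (hC : IsCompact C) {g : E → ℝ}
    (hg : IntegrableOn g C) :
    ∫ x in C, g x = ∫ s : ℝ, ∫ z in slice a n C s, g (a + (s • n + (z : E))) := by
  have he := measurePreserving_cylindricalEquiv (a := a) hn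
  have hint : Integrable fun x : ℝ × (ℝ ∙ n)ᗮ => C.indicator g (a + (x.1 • n + (x.2 : E))) := by
    simpa only [Function.comp_def, cylindricalEquiv_apply] using
      (he.integrable_comp_emb (cylindricalEquiv a n hn).measurableEmbedding).2
        ((integrable_indicator_iff hC.measurableSet).2 hg)
  have hslice (s : ℝ) : ∫ z : (ℝ ∙ n)ᗮ, C.indicator g (a + (s • n + (z : E))) =
      ∫ z in slice a n C s, g (a + (s • n + (z : E))) :=
    integral_indicator (f := fun z : (ℝ ∙ n)ᗮ => g (a + (s • n + (z : E))))
      (isCompact_slice hC a n s).measurableSet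
  rw [← integral_indicator hC.measurableSet, ← he.integral_comp']
  simp only [cylindricalEquiv_apply]
  rw [Measure.volume_eq_prod] at hint ⊢
  rw [integral_prod _ hint]
  simp only [hslice]

theorem setIntegral_convexJoin {d : ℕ} (hd : Module.finrank ℝ E = d + 1) (hn : ‖n‖ = 1)
    (hh : 0 < h) (hKc : IsCompact K) (hK : ∀ y ∈ K, ⟪n, y - a⟫_ℝ = h) {g : E → ℝ}
    (hg : Continuous g) :
    ∫ x in convexJoin ℝ {a} K, g x =
      ∫ y in K, (∫ s in 0..h, (s / h) ^ d * g (a + (s / h) • (y - a))) ∂μHE[d] := by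
  have hcone : IsCompact (convexJoin ℝ {a} K) := isCompact_convexJoin_singleton a hKc
  have hfib : ∀ᵐ s : ℝ, ∫ z in slice a n (convexJoin ℝ {a} K) s, g (a + (s • n + (z : E))) =
      (Set.Ioc 0 h).indicator
        (fun s => ∫ z in slice a n K h, (s / h) ^ d * g (a + (s / h) • (h • n + (z : E)))) s := by
    filter_upwards [Measure.ae_ne volume (0 : ℝ)] with s hs
    by_cases hsh : s ∈ Set.Ioc 0 h
    · rw [Set.indicator_of_mem hsh, setIntegral_slice_convexJoin hd hn hh hK hsh,
        integral_const_mul]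
    · rw [Set.indicator_of_notMem hsh, slice_convexJoin_of_notMem hn hh.le hK fun hmem =>
        hsh ⟨hmem.1.lt_of_ne' hs, hmem.2⟩, setIntegral_empty]
  have hint : Integrable (Function.uncurry fun (s : ℝ) (z : (ℝ ∙ n)ᗮ) =>
      (s / h) ^ d * g (a + (s / h) • (h • n + (z : E))))
      ((volume.restrict (Set.Ioc 0 h)).prod (volume.restrict (slice a n K h))) := by
    rw [Measure.prod_restrict]
    refine IntegrableOn.mono_set (t := Set.Icc 0 h ×ˢ slice a n K h) ?_
      (Set.prod_mono Set.Ioc_subset_Icc_self subset_rfl)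
    refine ContinuousOn.integrableOn_compact (isCompact_Icc.prod (isCompact_slice hKc a n h))
      (Continuous.continuousOn ?_)
    simp only [Function.uncurry_def]
    fun_prop
  rw [setIntegral_eq_integral_slice hn hcone (hg.continuousOn.integrableOn_compact hcone),
    integral_congr_ae hfib, integral_indicator measurableSet_Ioc, integral_integral_swap hint,
    setIntegral_hyperplane hd hn hK]
  simp only [add_sub_cancel_left, intervalIntegral.integral_of_le hh.le]

theorem integral_radial_derivative {F : Type*} [NormedAddCommGroup F] [NormedSpace ℝ F] {d : ℕ}
    {f : F → ℝ} (hf : ContDiff ℝ 1 f) (hh : 0 < h) (x w : F) :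
    ∫ s in 0..h, (s / h) ^ d *
      ((d + 1) * f (x + (s / h) • w) + fderiv ℝ f (x + (s / h) • w) ((s / h) • w)) =
      h * f (x + w) := by
  have := hf.continuous
  have := hf.continuous_fderiv one_ne_zero
  have hder (s : ℝ) : HasDerivAt (fun s : ℝ => h * ((s / h) ^ (d + 1) * f (x + (s / h) • w)))
      ((s / h) ^ d *
        ((d + 1) * f (x + (s / h) • w) + fderiv ℝ f (x + (s / h) • w) ((s / h) • w))) s := by
    have hdiv : HasDerivAt (fun s : ℝ => s / h) (1 / h) s := (hasDerivAt_id s).div_const h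
    have hray : HasDerivAt (fun s : ℝ => x + (s / h) • w) ((1 / h) • w) s :=
      (hdiv.smul_const w).const_add x
    have hcomp := (hf.differentiable one_ne_zero _).hasFDerivAt.comp_hasDerivAt s hray
    refine (((hdiv.fun_pow (d + 1)).fun_mul hcomp).const_mul h).congr_deriv ?_
    simp only [map_smul, smul_eq_mul, Function.comp_apply, add_tsub_cancel_right]
    push_cast
    rw [pow_succ]
    field_simp
  rw [intervalIntegral.integral_eq_sub_of_hasDerivAt (fun s _ => hder s)
    (Continuous.intervalIntegrable (by fun_prop) _ _)]
  simp [div_self hh.ne']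

theorem setIntegral_convexJoin_radial_derivative {d : ℕ} (hd : Module.finrank ℝ E = d + 1)
    (hn : ‖n‖ = 1) (hh : 0 < h) (hKc : IsCompact K) (hK : ∀ y ∈ K, ⟪n, y - a⟫_ℝ = h) {f : E → ℝ}
    (hf : ContDiff ℝ 1 f) :
    ∫ x in convexJoin ℝ {a} K, ((d + 1) * f x + fderiv ℝ f x (x - a)) =
      h * ∫ y in K, f y ∂μHE[d] := by
  have := hf.continuous
  have := hf.continuous_fderiv one_ne_zero
  rw [setIntegral_convexJoin hd hn hh hKc hK
    (g := fun x => (d + 1) * f x + fderiv ℝ f x (x - a)) (by fun_prop), ← integral_const_mul]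
  simp only [add_sub_cancel_left, integral_radial_derivative hf hh, add_sub_cancel]

end Cone

section ConvexBody

theorem eqOn_zero_of_setIntegral_eq_zero {E : Type*} [NormedAddCommGroup E] [NormedSpace ℝ E]
    [MeasurableSpace E] [BorelSpace E] {μ : Measure E} [μ.IsOpenPosMeasure]
    [IsFiniteMeasureOnCompacts μ] {K : Set E} (hK : IsCompact K) (hc : Convex ℝ K)
    (hi : (interior K).Nonempty) {g : E → ℝ} (hg : Continuous g) (hg₀ : ∀ x ∈ K, 0 ≤ g x)
    (hint : ∫ x in K, g x ∂μ = 0) : Set.EqOn g 0 K := by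
  have hae : g =ᵐ[μ.restrict K] 0 := by
    rwa [← setIntegral_eq_zero_iff_of_nonneg_ae]
    · exact (ae_restrict_iff' hK.measurableSet).2 (.of_forall hg₀)
    · exact hg.continuousOn.integrableOn_compact hK
  refine Measure.eqOn_of_ae_eq hae hg.continuousOn continuousOn_const ?_
  rw [hc.closure_interior_eq_closure_of_nonempty_interior hi]
  exact subset_closure

end ConvexBody

section Simplex

variable {E : Type*} [NormedAddCommGroup E] [InnerProductSpace ℝ E]

/-- `n` is the unit normal to `F`, a subset of an affine hyperplane, pointing away from `a`. -/
structure IsOutwardNormal (a : E) (F : Set E) (n : E) : Prop where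
  norm_eq_one : ‖n‖ = 1
  exists_height : ∃ h > 0, ∀ y ∈ F, ⟪n, y - a⟫_ℝ = h

theorem isOutwardNormal_normalize_starProjection {F : Set E}
    [(vectorSpan ℝ F).HasOrthogonalProjection] {a b : E} (hb : b ∈ affineSpan ℝ F)
    (ha : a ∉ affineSpan ℝ F) :
    IsOutwardNormal a F
      (NormedSpace.normalize ((vectorSpan ℝ F)ᗮ.starProjection (b - a))) := by
  set w := (vectorSpan ℝ F)ᗮ.starProjection (b - a) with w_def
  have hw : w ∈ (vectorSpan ℝ F)ᗮ := Submodule.starProjection_apply_mem _ _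
  have hw₀ : w ≠ 0 := by
    intro h
    rw [w_def, Submodule.starProjection_apply_eq_zero_iff, Submodule.orthogonal_orthogonal] at h
    refine ha ?_
    have hab : a - b ∈ (affineSpan ℝ F).direction := by
      simpa only [direction_affineSpan, neg_sub] using Submodule.neg_mem _ h
    simpa using AffineSubspace.vadd_mem_of_mem_direction hab hb
  refine ⟨NormedSpace.norm_normalize_eq_one_iff.2 hw₀, ‖w‖, norm_pos_iff.2 hw₀, fun y hy => ?_⟩
  have hyb : ⟪w, y - b⟫_ℝ = 0 := Submodule.inner_left_of_mem_orthogonal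
    (vsub_mem_vectorSpan_of_mem_affineSpan_of_mem_affineSpan (subset_affineSpan ℝ F hy) hb) hw
  have hba : ⟪w, b - a⟫_ℝ = ‖w‖ ^ 2 := by
    nth_rw 1 [← Submodule.starProjection_eq_self_iff.2 hw]
    rw [Submodule.inner_starProjection_left_eq_right, ← w_def, real_inner_self_eq_norm_sq]
  rw [← sub_add_sub_cancel y b a, inner_add_right, NormedSpace.normalize, real_inner_smul_left,
    real_inner_smul_left, hyb, hba]
  have := norm_ne_zero_iff.2 hw₀
  simp only [mul_zero, zero_add]
  field_simp

namespace IsOutwardNormal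

variable {a : E} {F : Set E} {n : E}

theorem inner_sub_eq_zero (hn : IsOutwardNormal a F n) {y z : E} (hy : y ∈ F) (hz : z ∈ F) :
    ⟪n, y - z⟫_ℝ = 0 := by
  obtain ⟨h, -, hF⟩ := hn.exists_height
  rw [← sub_sub_sub_cancel_right y z a, inner_sub_right, hF y hy, hF z hz, sub_self]

theorem convexHull_base (hn : IsOutwardNormal a F n) : IsOutwardNormal a (convexHull ℝ F) n := by
  obtain ⟨h, hh, hF⟩ := hn.exists_height
  refine ⟨hn.norm_eq_one, h, hh, fun y hy => ?_⟩
  simp only [inner_sub_right, sub_eq_iff_eq_add] at hF ⊢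
  exact convexHull_min hF (convex_hyperplane (innerₛₗ ℝ n).isLinear _) hy

theorem inner_sub_mem_Icc {h : ℝ} (hh : 0 ≤ h) (hF : ∀ y ∈ F, ⟪n, y - a⟫_ℝ = h) {x : E}
    (hx : x ∈ convexHull ℝ (insert a F)) : ⟪n, x - a⟫_ℝ ∈ Set.Icc 0 h := by
  have hconv : Convex ℝ {x : E | ⟪n, x⟫_ℝ ∈ Set.Icc ⟪n, a⟫_ℝ (⟪n, a⟫_ℝ + h)} :=
    (convex_Icc _ _).is_linear_preimage (innerₛₗ ℝ n).isLinear
  simp only [inner_sub_right, sub_eq_iff_eq_add'] at hF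
  have hsub : insert a F ⊆ {x : E | ⟪n, x⟫_ℝ ∈ Set.Icc ⟪n, a⟫_ℝ (⟪n, a⟫_ℝ + h)} :=
    Set.insert_subset ⟨le_rfl, le_add_of_nonneg_right hh⟩ fun y hy =>
      ⟨by linarith [hF y hy], (hF y hy).le⟩
  have hmem := convexHull_min hsub hconv hx
  rw [inner_sub_right]
  exact ⟨by linarith [hmem.1], by linarith [hmem.2]⟩

open scoped Pointwise in
theorem interior_slice_nonempty (hn : ‖n‖ = 1) {h : ℝ} (hh : 0 < h)
    (hF : ∀ y ∈ F, ⟪n, y - a⟫_ℝ = h) (hFconv : Convex ℝ F) (hFne : F.Nonempty)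
    (hint : (interior (convexHull ℝ (insert a F))).Nonempty) :
    (interior (slice a n F h)).Nonempty := by
  obtain ⟨x, hx⟩ := hint
  obtain ⟨y, hy⟩ := hFne
  set m := midpoint ℝ x y with m_def
  have hm : m ∈ interior (convexHull ℝ (insert a F)) :=
    (convex_convexHull ℝ _).openSegment_interior_self_subset_interior hx
      (subset_convexHull ℝ _ (Set.mem_insert_of_mem a hy)) (midpoint_mem_openSegment x y)
  set s := ⟪n, m - a⟫_ℝ with s_def
  have hs : s ∈ Set.Ioc 0 h := by
    refine ⟨?_, (inner_sub_mem_Icc hh.le hF (interior_subset hm)).2⟩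
    have hs_eq : s = 2⁻¹ * ⟪n, x - a⟫_ℝ + 2⁻¹ * ⟪n, y - a⟫_ℝ := by
      rw [← real_inner_smul_right, ← real_inner_smul_right, ← inner_add_right, s_def, m_def,
        midpoint_eq_smul_add, invOf_eq_inv]
      congr 1
      module
    have := (inner_sub_mem_Icc hh.le hF (interior_subset hx)).1
    rw [hs_eq, hF y hy]
    positivity
  have hopen : IsOpen (slice a n (interior (convexHull ℝ (insert a F))) s) :=
    isOpen_interior.preimage (by fun_prop)
  have hsub : slice a n (interior (convexHull ℝ (insert a F))) s ⊆
      interior ((s / h) • slice a n F h) := by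
    refine interior_maximal ?_ hopen
    rw [← slice_convexJoin hn hh hF hs, ← hFconv.convexHull_eq, ← convexHull_insert ⟨y, hy⟩,
      hFconv.convexHull_eq]
    exact Set.preimage_mono interior_subset
  have hmem : (⟨m - a - s • n, Submodule.mem_orthogonal_singleton_iff_inner_right.2 (by
      rw [inner_sub_right, real_inner_smul_right, real_inner_self_eq_norm_sq, hn]
      linarith)⟩ : (ℝ ∙ n)ᗮ) ∈ interior ((s / h) • slice a n F h) :=
    hsub (by simpa [slice] using hm)
  rw [interior_smul₀ (div_pos hs.1 hh).ne'] at hmem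
  exact Set.smul_set_nonempty.1 ⟨_, hmem⟩

theorem exists_eventually_mem (hn : IsOutwardNormal a F n) (hFconv : Convex ℝ F)
    (hFne : F.Nonempty) (hint : (interior (convexHull ℝ (insert a F))).Nonempty) :
    ∃ c ∈ F, ∀ᶠ y in nhds c, ⟪n, y - c⟫_ℝ = 0 → y ∈ F := by
  obtain ⟨h, hh, hF⟩ := hn.exists_height
  obtain ⟨z, hz⟩ := interior_slice_nonempty hn.norm_eq_one hh hF hFconv hFne hint
  have hzF : z ∈ slice a n F h := interior_subset hz
  have hc : a + (h • n + (z : E)) ∈ F := hzF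
  refine ⟨_, hc, ?_⟩
  obtain ⟨ε, hε, hball⟩ := Metric.isOpen_iff.1 isOpen_interior z hz
  filter_upwards [Metric.ball_mem_nhds _ hε] with y hy hyc
  let w : (ℝ ∙ n)ᗮ := ⟨y - (a + h • n), Submodule.mem_orthogonal_singleton_iff_inner_right.2 (by
    rw [← sub_add_cancel (y - (a + h • n)) (z : E), inner_add_right, sub_sub, add_assoc, hyc,
      inner_orthogonal_span_singleton, zero_add])⟩
  have hw : w ∈ slice a n F h := by
    refine interior_subset (hball ?_)
    rw [mem_ball_iff_norm] at hy ⊢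
    rwa [Submodule.coe_norm, Submodule.coe_sub, sub_sub, add_assoc]
  have hyw : y = a + (h • n + (w : E)) := by simp only [w]; abel
  rw [hyw]
  exact hw

theorem eq_or_eq_neg {b n' : E} (hn : IsOutwardNormal a F n)
    (hn' : IsOutwardNormal b F n') (hFconv : Convex ℝ F) (hFne : F.Nonempty)
    (hint : (interior (convexHull ℝ (insert a F))).Nonempty) : n' = n ∨ n' = -n := by
  obtain ⟨c, hc, hev⟩ := hn.exists_eventually_mem hFconv hFne hint
  have hn'_mem : n' ∈ (ℝ ∙ n)ᗮᗮ := by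
    rw [Submodule.mem_orthogonal]
    intro v hv
    have htendsto : Filter.Tendsto (fun ε : ℝ => c + ε • v) (nhdsWithin 0 (Set.Ioi 0)) (nhds c) :=
      (Continuous.tendsto' (by fun_prop) 0 c (by simp)).mono_left nhdsWithin_le_nhds
    obtain ⟨ε, hεF, hε⟩ := ((htendsto.eventually hev).and self_mem_nhdsWithin).exists
    have hvn : ⟪n, c + ε • v - c⟫_ℝ = 0 := by
      rw [add_sub_cancel_left, real_inner_smul_right,
        Submodule.mem_orthogonal_singleton_iff_inner_right.1 hv, mul_zero]
    have hvn' := hn'.inner_sub_eq_zero (hεF hvn) hc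
    rw [add_sub_cancel_left, real_inner_smul_right, mul_eq_zero] at hvn'
    rw [real_inner_comm]
    exact hvn'.resolve_left (ne_of_gt hε)
  rw [Submodule.orthogonal_orthogonal, Submodule.mem_span_singleton] at hn'_mem
  obtain ⟨r, rfl⟩ := hn'_mem
  have hr : |r| = 1 := by simpa [norm_smul, hn.norm_eq_one] using hn'.norm_eq_one
  rcases eq_or_eq_neg_of_abs_eq hr with rfl | rfl
  · exact .inl (one_smul ℝ n)
  · exact .inr (neg_one_smul ℝ n)

theorem eventually_add_smul_mem_convexHull {b c v : E} (hn : IsOutwardNormal b F n) (hc : c ∈ F)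
    (hev : ∀ᶠ y in nhds c, ⟪n, y - c⟫_ℝ = 0 → y ∈ F) (hv : ⟪n, v⟫_ℝ < 0) :
    ∀ᶠ ε in nhdsWithin (0 : ℝ) (Set.Ioi 0), c + ε • v ∈ convexHull ℝ (insert b F) := by
  obtain ⟨h, hh, hF⟩ := hn.exists_height
  have hh₀ := hh.ne'
  -- The point `c + ε • v` lies on the segment from `b` to the point `b + (r ε)⁻¹ • (c + ε • v - b)`
  -- of the base.
  let r : ℝ → ℝ := fun ε => (h + ε * ⟪n, v⟫_ℝ) / h
  have hr : ContinuousAt r 0 := by fun_prop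
  have hr₀ : r 0 = 1 := by simp [r, hh₀]
  have hbase : ContinuousAt (fun ε => b + (r ε)⁻¹ • (c + ε • v - b)) 0 := by
    have : r 0 ≠ 0 := hr₀ ▸ one_ne_zero
    fun_prop (disch := assumption)
  have htendsto : Filter.Tendsto (fun ε => b + (r ε)⁻¹ • (c + ε • v - b)) (nhds 0) (nhds c) := by
    convert hbase.tendsto using 2
    simp [hr₀]
  have hpos : ∀ᶠ ε in nhds 0, 0 < r ε := hr.eventually_const_lt (by simp [hr₀])
  filter_upwards [self_mem_nhdsWithin, nhdsWithin_le_nhds (htendsto.eventually hev),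
    nhdsWithin_le_nhds hpos] with ε hε hεF hr_pos
  have hr_le : r ε ≤ 1 := (div_le_one hh).2 (by nlinarith [Set.mem_Ioi.1 hε])
  have hy := hεF <| by
    have hrn := hr_pos.ne'
    rw [← sub_sub_sub_cancel_right _ c b, inner_sub_right, hF c hc, add_sub_cancel_left,
      real_inner_smul_right, add_sub_right_comm, inner_add_right, hF c hc, real_inner_smul_right,
      sub_eq_zero, inv_mul_eq_iff_eq_mul₀ hrn, div_mul_cancel₀ _ hh₀]
  have := (convex_convexHull ℝ _).add_smul_sub_mem
    (subset_convexHull ℝ _ (Set.mem_insert b F))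
    (subset_convexHull ℝ _ (Set.mem_insert_of_mem _ hy)) ⟨hr_pos.le, hr_le⟩
  simpa [smul_inv_smul₀ hr_pos.ne'] using this

theorem not_convexHull_inter_subset {b : E} (hn : IsOutwardNormal a F n)
    (hn' : IsOutwardNormal b F n) (hFconv : Convex ℝ F) (hFne : F.Nonempty)
    (hint : (interior (convexHull ℝ (insert a F))).Nonempty) :
    ¬ convexHull ℝ (insert a F) ∩ convexHull ℝ (insert b F) ⊆ F := by
  intro hsub
  obtain ⟨c, hc, hev⟩ := hn.exists_eventually_mem hFconv hFne hint
  obtain ⟨h, hh, hF⟩ := hn.exists_height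
  have hac : ⟪n, a - c⟫_ℝ = -h := by rw [← neg_sub, inner_neg_right, hF c hc]
  obtain ⟨ε, hεb, hε, hε_one⟩ := ((hn'.eventually_add_smul_mem_convexHull hc hev
    (hac ▸ neg_lt_zero.2 hh)).and (Ioo_mem_nhdsGT zero_lt_one)).exists
  have hεa : c + ε • (a - c) ∈ convexHull ℝ (insert a F) :=
    (convex_convexHull ℝ _).add_smul_sub_mem
      (subset_convexHull ℝ _ (Set.mem_insert_of_mem _ hc))
      (subset_convexHull ℝ _ (Set.mem_insert _ _)) ⟨hε.le, hε_one.le⟩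
  have hheight := hn.inner_sub_eq_zero (hsub ⟨hεa, hεb⟩) hc
  rw [add_sub_cancel_left, real_inner_smul_right, hac] at hheight
  nlinarith [mul_pos hε hh]

theorem eq_neg {b n' : E} (hn : IsOutwardNormal a F n)
    (hn' : IsOutwardNormal b F n') (hFne : F.Nonempty)
    (hint : (interior (convexHull ℝ (insert a F))).Nonempty)
    (hinter : convexHull ℝ (insert a F) ∩ convexHull ℝ (insert b F) ⊆ convexHull ℝ F) :
    n' = -n := by
  have hinsert (x : E) : convexHull ℝ (insert x (convexHull ℝ F)) = convexHull ℝ (insert x F) := by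
    rw [convexHull_insert hFne, convexHull_insert hFne.convexHull,
      (convex_convexHull ℝ F).convexHull_eq]
  have hconv := convex_convexHull ℝ F
  rw [← hinsert a] at hint
  rw [← hinsert a, ← hinsert b] at hinter
  refine (hn.convexHull_base.eq_or_eq_neg hn'.convexHull_base hconv hFne.convexHull
    hint).resolve_left ?_
  rintro rfl
  exact hn.convexHull_base.not_convexHull_inter_subset hn'.convexHull_base hconv hFne.convexHull
    hint hinter

section Integral

variable [FiniteDimensional ℝ E] [MeasurableSpace E] [BorelSpace E]

theorem integrableOn {d : ℕ} (hd : Module.finrank ℝ E = d + 1) (hn : IsOutwardNormal a F n)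
    (hF : IsCompact F) {g : E → ℝ} (hg : Continuous g) : IntegrableOn g F μHE[d] := by
  obtain ⟨h, -, hFh⟩ := hn.exists_height
  exact integrableOn_hyperplane hd hn.norm_eq_one hF hFh hg

theorem eqOn_zero_of_setIntegral_eq_zero {d : ℕ} (hd : Module.finrank ℝ E = d + 1)
    (hn : IsOutwardNormal a F n) (hF : IsCompact F) (hFconv : Convex ℝ F)
    (hint : (interior (convexHull ℝ (insert a F))).Nonempty) {g : E → ℝ} (hg : Continuous g)
    (hg₀ : ∀ x ∈ F, 0 ≤ g x) (hg_int : ∫ x in F, g x ∂μHE[d] = 0) : Set.EqOn g 0 F := by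
  rcases F.eq_empty_or_nonempty with rfl | hFne
  · exact Set.eqOn_empty g 0
  obtain ⟨h, hh, hFh⟩ := hn.exists_height
  rw [setIntegral_hyperplane hd hn.norm_eq_one hFh] at hg_int
  have hslice : Convex ℝ (slice a n F h) := by
    intro z hz w hw s t hs ht hst
    have hzw := hFconv hz hw hs ht hst
    simp only [slice, Set.mem_ofPred_eq]
    convert hzw using 1
    rw [Submodule.coe_add, Submodule.coe_smul, Submodule.coe_smul]
    nth_rw 1 [← one_smul ℝ a]
    nth_rw 1 [← one_smul ℝ (h • n)]
    rw [← hst]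
    module
  have hzero := StokesHDG.eqOn_zero_of_setIntegral_eq_zero (isCompact_slice hF a n h) hslice
    (interior_slice_nonempty hn.norm_eq_one hh hFh hFconv hFne hint) (by fun_prop)
    (fun z hz => hg₀ _ hz) hg_int
  intro y hy
  have hyn : y - (a + h • n) ∈ (ℝ ∙ n)ᗮ := by
    rw [Submodule.mem_orthogonal_singleton_iff_inner_right, ← sub_sub, inner_sub_right, hFh y hy,
      real_inner_smul_right, real_inner_self_eq_norm_sq, hn.norm_eq_one]
    ring
  have hy_eq : a + (h • n + (y - (a + h • n))) = y := by abel
  simpa [hy_eq] using hzero (x := ⟨_, hyn⟩) (by simpa [slice, hy_eq] using hy)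

theorem setIntegral_convexHull_radial_derivative {d : ℕ} (hd : Module.finrank ℝ E = d + 1)
    (hn : IsOutwardNormal a F n) (hF : F.Finite) {e : E} (he : e ∈ F) {f : E → ℝ}
    (hf : ContDiff ℝ 1 f) :
    ∫ x in convexHull ℝ (insert a F), ((d + 1) * f x + fderiv ℝ f x (x - a)) =
      ⟪n, e - a⟫_ℝ * ∫ y in convexHull ℝ F, f y ∂μHE[d] := by
  obtain ⟨h, hh, hFh⟩ := hn.convexHull_base.exists_height
  rw [convexHull_insert ⟨e, he⟩, hFh e (subset_convexHull ℝ F he)]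
  exact setIntegral_convexJoin_radial_derivative hd hn.norm_eq_one hh
    (hF.isCompact_convexHull ℝ) hFh hf

end Integral

end IsOutwardNormal

section Divergence

variable [FiniteDimensional ℝ E] [MeasurableSpace E] [BorelSpace E] [DecidableEq E]
  {d : ℕ} {S : Finset E} {ν : E → E}

-- The cone formulas for the two apexes `a` and `b` differ by the derivative along `a - b`.
theorem setIntegral_fderiv_sub (hd : Module.finrank ℝ E = d + 1)
    (hν : ∀ c ∈ S, IsOutwardNormal c (S.erase c : Finset E) (ν c)) {f : E → ℝ}
    (hf : ContDiff ℝ 1 f) {a b : E} (ha : a ∈ S) (hb : b ∈ S) :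
    ∫ x in convexHull ℝ (S : Set E), fderiv ℝ f x (a - b) =
      ∑ c ∈ S, ⟪ν c, a - b⟫_ℝ * ∫ x in convexHull ℝ (S.erase c : Finset E), f x ∂μHE[d] := by
  rcases eq_or_ne a b with rfl | hab
  · simp
  have cone {c e : E} (hc : c ∈ S) (he : e ∈ S) (hec : e ≠ c) :
      ∫ x in convexHull ℝ (S : Set E), ((d + 1) * f x + fderiv ℝ f x (x - c)) =
        ⟪ν c, e - c⟫_ℝ * ∫ x in convexHull ℝ (S.erase c : Finset E), f x ∂μHE[d] := by
    have := (hν c hc).setIntegral_convexHull_radial_derivative hd (S.erase c).finite_toSet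
      (Finset.mem_coe.2 (Finset.mem_erase.2 ⟨hec, he⟩)) hf
    rwa [← Finset.coe_insert, Finset.insert_erase hc] at this
  have hint (c : E) : IntegrableOn (fun x => (d + 1) * f x + fderiv ℝ f x (x - c))
      (convexHull ℝ (S : Set E)) := by
    have := hf.continuous_fderiv one_ne_zero
    have := hf.continuous
    exact Continuous.continuousOn (by fun_prop) |>.integrableOn_compact
      (S.finite_toSet.isCompact_convexHull ℝ)
  have hsub : ∫ x in convexHull ℝ (S : Set E), fderiv ℝ f x (a - b) =
      (∫ x in convexHull ℝ (S : Set E), ((d + 1) * f x + fderiv ℝ f x (x - b))) -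
        ∫ x in convexHull ℝ (S : Set E), ((d + 1) * f x + fderiv ℝ f x (x - a)) := by
    rw [← integral_sub (hint b) (hint a)]
    simp only [add_sub_add_left_eq_sub, ← map_sub, sub_sub_sub_cancel_left]
  rw [Finset.sum_eq_add_of_mem a b ha hb hab, hsub, cone ha hb hab.symm, cone hb ha hab,
    ← neg_sub a b, inner_neg_right]
  · ring
  · intro c hc hcab
    rw [(hν c hc).inner_sub_eq_zero (Finset.mem_coe.2 (Finset.mem_erase.2 ⟨hcab.1.symm, ha⟩))
      (Finset.mem_coe.2 (Finset.mem_erase.2 ⟨hcab.2.symm, hb⟩)), zero_mul]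

theorem setIntegral_fderiv (hd : Module.finrank ℝ E = d + 1)
    (hν : ∀ c ∈ S, IsOutwardNormal c (S.erase c : Finset E) (ν c))
    (hS : affineSpan ℝ (S : Set E) = ⊤) {f : E → ℝ} (hf : ContDiff ℝ 1 f) (t : E) :
    ∫ x in convexHull ℝ (S : Set E), fderiv ℝ f x t =
      ∑ c ∈ S, ⟪ν c, t⟫_ℝ * ∫ x in convexHull ℝ (S.erase c : Finset E), f x ∂μHE[d] := by
  have hint : IntegrableOn (fderiv ℝ f) (convexHull ℝ (S : Set E)) :=
    (hf.continuous_fderiv one_ne_zero).continuousOn.integrableOn_compact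
      (S.finite_toSet.isCompact_convexHull ℝ)
  let φ : E →ₗ[ℝ] ℝ := (∫ x in convexHull ℝ (S : Set E), fderiv ℝ f x).toLinearMap
  let ψ : E →ₗ[ℝ] ℝ := ∑ c ∈ S,
    (∫ x in convexHull ℝ (S.erase c : Finset E), f x ∂μHE[d]) • innerₛₗ ℝ (ν c)
  have hφ (t : E) : φ t = ∫ x in convexHull ℝ (S : Set E), fderiv ℝ f x t :=
    ContinuousLinearMap.integral_apply hint t
  have hψ (t : E) : ψ t =
      ∑ c ∈ S, ⟪ν c, t⟫_ℝ * ∫ x in convexHull ℝ (S.erase c : Finset E), f x ∂μHE[d] := by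
    simp only [ψ, LinearMap.sum_apply, LinearMap.smul_apply, innerₛₗ_apply_apply, smul_eq_mul,
      mul_comm]
  have hspan : t ∈ vectorSpan ℝ (S : Set E) := by
    rw [← direction_affineSpan, hS, AffineSubspace.direction_top]
    exact Submodule.mem_top
  rw [← hφ, ← hψ]
  refine LinearMap.eqOn_span (s := (S : Set E) -ᵥ S) ?_ hspan
  rintro _ ⟨a, ha, b, hb, rfl⟩
  rw [hφ, hψ]
  exact setIntegral_fderiv_sub hd hν hf ha hb

end Divergence

end Simplex

section Tetrahedron

/-- The vertex sets of nondegenerate tetrahedra. -/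
structure IsTetrahedron (T : Finset Pt) : Prop where
  affineIndependent : AffineIndependent ℝ ((↑) : T → Pt)
  card_eq_four : T.card = 4

theorem isCompact_hull (T : Finset Pt) : IsCompact (hull T) :=
  T.finite_toSet.isCompact_convexHull ℝ

theorem card_smul_centroid {T : Finset Pt} (hT : T.Nonempty) :
    (T.card : ℝ) • T.centroid ℝ id = ∑ x ∈ T, x := by
  rw [T.centroid_eq_centerMass hT, Finset.centerMass_eq_of_sum_1 _ _
    (T.sum_centroidWeights_eq_one_of_nonempty ℝ hT)]
  simp only [Finset.centroidWeights_apply, id]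
  rw [← Finset.smul_sum, smul_inv_smul₀ (Nat.cast_ne_zero.2 (Finset.card_ne_zero.2 hT))]

theorem card_smul_centroid_erase_sub_centroid {T : Finset Pt} {a : Pt} (ha : a ∈ T)
    (hTa : (T.erase a).Nonempty) :
    (T.card : ℝ) • ((T.erase a).centroid ℝ id - T.centroid ℝ id) =
      (T.erase a).centroid ℝ id - a := by
  rw [smul_sub, card_smul_centroid ⟨a, ha⟩, ← Finset.sum_erase_add T _ ha,
    ← card_smul_centroid hTa, ← Finset.card_erase_add_one ha]
  push_cast
  module

namespace IsTetrahedron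

variable {T : Finset Pt} (hT : IsTetrahedron T)
include hT

theorem affineSpan_eq_top : affineSpan ℝ (T : Set Pt) = ⊤ := by
  have := hT.affineIndependent.affineSpan_eq_top_iff_card_eq_finrank_add_one (k := ℝ)
  rw [Subtype.range_coe] at this
  simpa [hT.card_eq_four] using this

theorem interior_hull_nonempty : (interior (hull T)).Nonempty :=
  interior_convexHull_nonempty_iff_affineSpan_eq_top.2 hT.affineSpan_eq_top

variable {a : Pt} (ha : a ∈ T)
include ha

theorem erase_nonempty : (T.erase a).Nonempty := by
  rw [← Finset.card_pos, Finset.card_erase_of_mem ha, hT.card_eq_four]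
  norm_num

theorem isOutwardNormal : IsOutwardNormal a (T.erase a : Finset Pt) (normal T (T.erase a)) := by
  have hmem : (T.erase a).centroid ℝ id ∈ affineSpan ℝ ((T.erase a : Finset Pt) : Set Pt) :=
    convexHull_subset_affineSpan _ ((T.erase a).centroid_mem_convexHull (hT.erase_nonempty ha))
  have hnot : a ∉ affineSpan ℝ ((T.erase a : Finset Pt) : Set Pt) := by
    have himage : ((T.erase a : Finset Pt) : Set Pt) =
        ((↑) : T → Pt) '' (Set.univ \ {⟨a, ha⟩}) := by
      ext x
      simp [and_comm]
    rw [himage]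
    exact hT.affineIndependent.notMem_affineSpan_sdiff ⟨a, ha⟩ Set.univ
  have := isOutwardNormal_normalize_starProjection hmem hnot
  rwa [← card_smul_centroid_erase_sub_centroid ha (hT.erase_nonempty ha), map_smul,
    NormedSpace.normalize_smul_of_pos (by rw [hT.card_eq_four]; norm_num)] at this

theorem interior_convexHull_insert_nonempty :
    (interior (convexHull ℝ (insert a (hull (T.erase a))))).Nonempty := by
  have hne : ((T.erase a : Finset Pt) : Set Pt).Nonempty := hT.erase_nonempty ha
  rw [convexHull_insert hne.convexHull, (convex_convexHull ℝ _).convexHull_eq,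
    ← convexHull_insert hne, ← Finset.coe_insert, Finset.insert_erase ha]
  exact hT.interior_hull_nonempty

theorem integrableOn_hull_erase {g : Pt → ℝ} (hg : Continuous g) :
    IntegrableOn g (hull (T.erase a)) μHE[2] :=
  (hT.isOutwardNormal ha).convexHull_base.integrableOn (by simp)
    (isCompact_hull _) hg

theorem eqOn_zero_of_setIntegral_hull_erase_eq_zero {g : Pt → ℝ} (hg : Continuous g)
    (hg₀ : ∀ x ∈ hull (T.erase a), 0 ≤ g x) (hint : ∫ x in hull (T.erase a), g x ∂μHE[2] = 0) :
    Set.EqOn g 0 (hull (T.erase a)) :=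
  (hT.isOutwardNormal ha).convexHull_base.eqOn_zero_of_setIntegral_eq_zero (by simp)
    (isCompact_hull _) (convex_convexHull ℝ _)
    (hT.interior_convexHull_insert_nonempty ha) hg hg₀ hint

omit ha in
theorem setIntegral_fderiv {f : Pt → ℝ} (hf : ContDiff ℝ 1 f) (t : Pt) :
    ∫ x in hull T, fderiv ℝ f x t =
      ∑ c ∈ T, ⟪normal T (T.erase c), t⟫_ℝ * ∫ x in hull (T.erase c), f x ∂μHE[2] :=
  StokesHDG.setIntegral_fderiv (by simp) (ν := fun c => normal T (T.erase c))
    (fun _ hc => hT.isOutwardNormal hc) hT.affineSpan_eq_top hf t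

end IsTetrahedron

end Tetrahedron

namespace Mesh

variable {Ω : Set Pt} (M : Mesh Ω)

theorem cell_mem_faces (T : M.cells) : (T : Finset Pt) ∈ M.faces := by
  simpa using (Finset.mem_filter.1 T.2).1

theorem facet_mem_faces (F : M.facets) : (F : Finset Pt) ∈ M.faces := by
  simpa using (Finset.mem_filter.1 F.2).1

theorem card_facet (F : M.facets) : (F : Finset Pt).card = 3 := (Finset.mem_filter.1 F.2).2

theorem isTetrahedron (T : M.cells) : IsTetrahedron T where
  affineIndependent := M.indep (M.cell_mem_faces T)
  card_eq_four := (Finset.mem_filter.1 T.2).2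

variable {M} {T T' : M.cells} {F : M.facets}

theorem mem_facetsOf : F ∈ M.facetsOf T ↔ (F : Finset Pt) ⊆ T := by simp [facetsOf]

theorem exists_eq_erase_of_mem_facetsOf (h : F ∈ M.facetsOf T) :
    ∃ a ∈ (T : Finset Pt), (F : Finset Pt) = (T : Finset Pt).erase a := by
  have hcard : (F : Finset Pt).card + 1 = (T : Finset Pt).card := by
    rw [M.card_facet, (M.isTetrahedron T).card_eq_four]
  obtain ⟨a, ha, hins⟩ := Finset.exists_eq_insert_iff.2 ⟨mem_facetsOf.1 h, hcard⟩
  exact ⟨a, hins ▸ Finset.mem_insert_self a F, by rw [← hins, Finset.erase_insert ha]⟩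

theorem exists_facet_eq_erase {a : Pt} (ha : a ∈ (T : Finset Pt)) :
    ∃ F ∈ M.facetsOf T, (F : Finset Pt) = (T : Finset Pt).erase a := by
  have hcard : ((T : Finset Pt).erase a).card = 3 := by
    rw [Finset.card_erase_of_mem ha, (M.isTetrahedron T).card_eq_four]
  have hface : (T : Finset Pt).erase a ∈ M.faces :=
    M.down_closed (M.cell_mem_faces T) (Finset.erase_subset _ _)
      ((M.isTetrahedron T).erase_nonempty ha)
  exact ⟨⟨_, Finset.mem_filter.2 ⟨by simpa using hface, hcard⟩⟩,
    mem_facetsOf.2 (Finset.erase_subset _ _), rfl⟩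

variable (T) in
theorem sum_facetsOf (φ : Finset Pt → ℝ) :
    ∑ F ∈ M.facetsOf T, φ F = ∑ a ∈ (T : Finset Pt), φ ((T : Finset Pt).erase a) := by
  have himage : (M.facetsOf T).image Subtype.val =
      (T : Finset Pt).image (T : Finset Pt).erase := by
    ext s
    simp only [Finset.mem_image]
    constructor
    · rintro ⟨F, hF, rfl⟩
      obtain ⟨a, ha, hFa⟩ := exists_eq_erase_of_mem_facetsOf hF
      exact ⟨a, ha, hFa.symm⟩
    · rintro ⟨a, ha, rfl⟩
      exact exists_facet_eq_erase ha
  rw [← Finset.sum_image (f := φ) Subtype.val_injective.injOn, himage,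
    Finset.sum_image (Finset.erase_injOn _)]

theorem exists_mem_facetsOf (F : M.facets) : ∃ T : M.cells, F ∈ M.facetsOf T := by
  obtain ⟨T, hT, hFT, hcard⟩ := M.pure _ (M.facet_mem_faces F)
  exact ⟨⟨T, Finset.mem_filter.2 ⟨by simpa using hT, hcard⟩⟩, mem_facetsOf.2 hFT⟩

theorem norm_normal (h : F ∈ M.facetsOf T) : ‖normal T F‖ = 1 := by
  obtain ⟨a, ha, hF⟩ := exists_eq_erase_of_mem_facetsOf h
  exact hF ▸ ((M.isTetrahedron T).isOutwardNormal ha).norm_eq_one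

theorem normal_eq_neg (h : F ∈ M.facetsOf T) (h' : F ∈ M.facetsOf T') (hne : T ≠ T') :
    normal T' F = -normal T F := by
  obtain ⟨a, ha, hF⟩ := exists_eq_erase_of_mem_facetsOf h
  obtain ⟨b, hb, hF'⟩ := exists_eq_erase_of_mem_facetsOf h'
  have hn := (M.isTetrahedron T).isOutwardNormal ha
  have hn' := (M.isTetrahedron T').isOutwardNormal hb
  have hT : insert a (F : Finset Pt) = T := hF ▸ Finset.insert_erase ha
  have hT' : insert b (F : Finset Pt) = T' := hF' ▸ Finset.insert_erase hb
  rw [← hF] at hn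
  rw [← hF'] at hn'
  have haT' : a ∉ (T' : Finset Pt) := by
    intro haT'
    refine hne (Subtype.ext (Finset.eq_of_subset_of_card_le ?_ ?_))
    · rw [← hT]
      exact Finset.insert_subset haT' (mem_facetsOf.1 h')
    · rw [(M.isTetrahedron T).card_eq_four, (M.isTetrahedron T').card_eq_four]
  refine hn.eq_neg hn' ?_ ?_ ?_
  · exact Finset.card_pos.1 (by rw [M.card_facet]; norm_num)
  · rw [← Finset.coe_insert, hT]
    exact (M.isTetrahedron T).interior_hull_nonempty
  · rw [← Finset.coe_insert, ← Finset.coe_insert, hT, hT']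
    refine (M.inter_subset_convexHull (M.cell_mem_faces T) (M.cell_mem_faces T')).trans
      (convexHull_mono ?_)
    rintro x ⟨hxT, hxT'⟩
    rw [← hT, Finset.coe_insert] at hxT
    exact hxT.resolve_left fun hxa => haT' (hxa ▸ hxT')

open Classical in
theorem sum_normal_eq_zero (hF : ¬ M.IsBoundary F) :
    ∑ T : M.cells with F ∈ M.facetsOf T, normal T F = 0 := by
  obtain ⟨T₁, h₁⟩ := exists_mem_facetsOf F
  obtain ⟨T₂, h₂, hne⟩ : ∃ T₂, F ∈ M.facetsOf T₂ ∧ T₂ ≠ T₁ := by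
    by_contra! h
    exact hF ⟨T₁, h₁, h⟩
  have hpair : (Finset.univ.filter fun T : M.cells => F ∈ M.facetsOf T) = {T₁, T₂} := by
    ext T
    simp only [Finset.mem_filter, Finset.mem_univ, true_and, Finset.mem_insert,
      Finset.mem_singleton]
    refine ⟨fun h => ?_, by rintro (rfl | rfl) <;> assumption⟩
    -- A third cell at `F` would have the normals opposite to both of two opposite normals.
    by_contra! hT
    have hzero : normal T₁ F = -normal T₁ F := by
      conv_lhs => rw [normal_eq_neg h h₁ hT.1, ← normal_eq_neg h h₂ hT.2,
        normal_eq_neg h₁ h₂ hne.symm]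
    have : IsAddTorsionFree Pt := .of_isTorsionFree ℝ Pt
    have hnorm := norm_normal h₁
    rw [self_eq_neg.1 hzero, norm_zero] at hnorm
    exact zero_ne_one hnorm
  rw [hpair, Finset.sum_pair hne.symm, normal_eq_neg h₁ h₂ hne.symm, add_neg_cancel]

end Mesh

section Polynomial

theorem ev_zero (x : Pt) : ev 0 x = 0 := by simp [ev]
theorem ev_one (x : Pt) : ev 1 x = 1 := by simp [ev]
theorem ev_C (c : ℝ) (x : Pt) : ev (MvPolynomial.C c) x = c := by simp [ev]
theorem ev_X (i : Fin 3) (x : Pt) : ev (MvPolynomial.X i) x = x i := by simp [ev]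
theorem ev_add (p q : Poly) (x : Pt) : ev (p + q) x = ev p x + ev q x := by simp [ev]
theorem ev_sub (p q : Poly) (x : Pt) : ev (p - q) x = ev p x - ev q x := by simp [ev]
theorem ev_neg (p : Poly) (x : Pt) : ev (-p) x = -ev p x := by simp [ev]
theorem ev_mul (p q : Poly) (x : Pt) : ev (p * q) x = ev p x * ev q x := by simp [ev]
theorem ev_smul (c : ℝ) (p : Poly) (x : Pt) : ev (c • p) x = c * ev p x := by simp [ev]
theorem ev_sum {ι : Type*} (s : Finset ι) (p : ι → Poly) (x : Pt) :
    ev (∑ i ∈ s, p i) x = ∑ i ∈ s, ev (p i) x := by simp [ev]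

theorem contDiff_ev (q : Poly) : ContDiff ℝ 1 (ev q) := by
  induction q using MvPolynomial.induction_on with
  | C c => simpa only [funext (ev_C c)] using contDiff_const
  | add p q hp hq => simpa only [← funext (ev_add p q)] using hp.add hq
  | mul_X p i hp =>
    have hX : ContDiff ℝ 1 fun x : Pt => x i := by fun_prop
    simpa only [← ev_X i, ← funext (ev_mul p _)] using hp.mul hX

@[fun_prop]
theorem continuous_ev (q : Poly) : Continuous (ev q) := (contDiff_ev q).continuous

/-- The directional derivative `t · ∇` of polynomials. -/
noncomputable def ddir : Pt →ₗ[ℝ] Derivation ℝ Poly Poly :=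
  ∑ j, (EuclideanSpace.projₗ j).smulRight (MvPolynomial.pderiv j)

theorem ddir_apply (t : Pt) (q : Poly) : ddir t q = ∑ j, t j • dd j q := by
  simp [ddir, Fin.sum_univ_three]

theorem ddir_X (t : Pt) (i : Fin 3) : ddir t (MvPolynomial.X i) = MvPolynomial.C (t i) := by
  simp [ddir_apply, MvPolynomial.pderiv_X, Pi.single_apply, MvPolynomial.smul_eq_C_mul]

theorem ddir_single (j : Fin 3) (q : Poly) : ddir (EuclideanSpace.single j 1) q = dd j q := by
  simp [ddir_apply, ite_smul]

theorem fderiv_ev (q : Poly) (x t : Pt) : fderiv ℝ (ev q) x t = ev (ddir t q) x := by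
  have hd (q : Poly) : DifferentiableAt ℝ (ev q) x := (contDiff_ev q).differentiable one_ne_zero x
  induction q using MvPolynomial.induction_on with
  | C c =>
    have hconst : ev (MvPolynomial.C c) = fun _ => c := funext (ev_C c)
    have hddir : ddir t (MvPolynomial.C c) = 0 := (ddir t).map_algebraMap c
    simp [hconst, hddir, ev_zero]
  | add p q hp hq =>
    have hadd : ev (p + q) = ev p + ev q := funext (ev_add p q)
    rw [hadd, fderiv_add (hd p) (hd q), map_add, ev_add, ← hp, ← hq]
    rfl
  | mul_X p i hp =>
    have hX : ev (MvPolynomial.X i) = (EuclideanSpace.proj i : Pt →L[ℝ] ℝ) := funext (ev_X i)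
    have hmul : ev (p * MvPolynomial.X i) = ev p * ev (MvPolynomial.X i) := funext (ev_mul p _)
    rw [hmul, fderiv_mul (hd p) (hd _), hX, ContinuousLinearMap.fderiv, Derivation.leibniz, ddir_X]
    simp [ev_add, ev_mul, ev_X, ev_C, ← hp]

theorem mem_P {k : ℕ} {q : Poly} : q ∈ P k ↔ q.totalDegree ≤ k :=
  MvPolynomial.mem_restrictTotalDegree _ _ _

theorem mul_mem_P {k m : ℕ} {p q : Poly} (hp : p ∈ P k) (hq : q ∈ P m) : p * q ∈ P (k + m) :=
  mem_P.2 ((MvPolynomial.totalDegree_mul p q).trans (add_le_add (mem_P.1 hp) (mem_P.1 hq)))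

theorem totalDegree_dd_le (j : Fin 3) (q : Poly) : (dd j q).totalDegree ≤ q.totalDegree - 1 := by
  conv_lhs => rw [q.as_sum]
  rw [dd, map_sum]
  refine (MvPolynomial.totalDegree_finsetSum _ _).trans (Finset.sup_le fun s hs => ?_)
  rw [MvPolynomial.pderiv_monomial]
  rcases eq_or_ne (s j) 0 with hj | hj
  · simp [hj]
  have hdeg : (s - Finsupp.single j 1).degree + 1 = s.degree := by
    have hle : Finsupp.single j 1 ≤ s := Finsupp.single_le_iff.2 (Nat.one_le_iff_ne_zero.2 hj)
    conv_rhs => rw [← tsub_add_cancel_of_le hle, map_add, Finsupp.degree_single]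
  have hle : s.degree ≤ q.totalDegree := MvPolynomial.le_totalDegree hs
  refine (MvPolynomial.totalDegree_monomial_le _ _).trans ?_
  change (s - Finsupp.single j 1).degree ≤ _
  lia

theorem ddir_mem_P {k : ℕ} {q : Poly} (hq : q ∈ P k) (t : Pt) : ddir t q ∈ P (k - 1) := by
  rw [ddir_apply]
  exact Submodule.sum_mem _ fun j _ => Submodule.smul_mem _ _
    (mem_P.2 ((totalDegree_dd_le j q).trans (Nat.sub_le_sub_right (mem_P.1 hq) 1)))

theorem ddir_eq_zero_of_mem_P_zero {q : Poly} (hq : q ∈ P 0) (t : Pt) : ddir t q = 0 := by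
  rw [MvPolynomial.totalDegree_eq_zero_iff_eq_C.1 (Nat.le_zero.1 (mem_P.1 hq))]
  exact (ddir t).map_algebraMap _

theorem mul_ddir_mem_P {k : ℕ} {l q : Poly} (hl : l ∈ P 1) (hq : q ∈ P k) (t : Pt) :
    l * ddir t q ∈ P k := by
  rcases k.eq_zero_or_pos with rfl | hk
  · simp [ddir_eq_zero_of_mem_P_zero hq]
  · simpa only [Nat.add_sub_cancel' hk] using mul_mem_P hl (ddir_mem_P hq t)

/-- The integral of a polynomial over a simplex. -/
noncomputable def cellInt (T : Finset Pt) : Poly →ₗ[ℝ] ℝ where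
  toFun q := ∫ x in hull T, ev q x
  map_add' p q := by
    simp only [ev_add]
    exact integral_add ((continuous_ev p).continuousOn.integrableOn_compact (isCompact_hull T))
      ((continuous_ev q).continuousOn.integrableOn_compact (isCompact_hull T))
  map_smul' c q := by
    simp only [ev_smul, RingHom.id_apply, smul_eq_mul]
    exact integral_const_mul _ _

theorem cellInt_apply (T : Finset Pt) (q : Poly) : cellInt T q = ∫ x in hull T, ev q x := rfl

theorem cellInner_ev {ι : Type} [Fintype ι] (T : Finset Pt) (a b : ι → Poly) :
    cellInner T (fun i => ev (a i)) (fun i => ev (b i)) = ∑ i, cellInt T (a i * b i) := by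
  rw [← map_sum, cellInt_apply, cellInner]
  simp only [ev_sum, ev_mul]

end Polynomial

namespace IsTetrahedron

variable {T : Finset Pt} (hT : IsTetrahedron T)
include hT

theorem eq_zero_of_ev_eq_zero {q : Poly} (hq : ∀ x ∈ hull T, ev q x = 0) : q = 0 := by
  obtain ⟨x, hx⟩ := hT.interior_hull_nonempty
  have hopen : IsOpen (WithLp.ofLp '' interior (hull T) : Set (Fin 3 → ℝ)) :=
    (PiLp.homeomorph 2 _).isOpenMap _ isOpen_interior
  obtain ⟨ε, hε, hball⟩ := Metric.isOpen_iff.1 hopen _ ⟨x, hx, rfl⟩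
  refine MvPolynomial.funext_set (fun i => Metric.ball (x i) ε) (fun i => ?_) fun y hy => ?_
  · rw [Real.ball_eq_Ioo]
    exact Set.Ioo_infinite (by linarith)
  · rw [← ball_pi _ hε] at hy
    obtain ⟨z, hz, rfl⟩ := hball hy
    simpa [ev] using hq z (interior_subset hz)

theorem eq_zero_of_cellInt_eq_zero {q : Poly} (hq : ∀ x ∈ hull T, 0 ≤ ev q x)
    (hint : cellInt T q = 0) : q = 0 :=
  hT.eq_zero_of_ev_eq_zero (eqOn_zero_of_setIntegral_eq_zero (isCompact_hull T)
    (convex_convexHull ℝ _) hT.interior_hull_nonempty (continuous_ev q) hq hint)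

theorem eq_zero_of_cellInt_mul_mul_self_eq_zero {l q : Poly} (hl₀ : l ≠ 0)
    (hl : ∀ x ∈ hull T, 0 ≤ ev l x) (hint : cellInt T (l * (q * q)) = 0) : q = 0 := by
  refine mul_self_eq_zero.1 ((mul_eq_zero.1 (hT.eq_zero_of_cellInt_eq_zero (fun x hx => ?_)
    hint)).resolve_left hl₀)
  rw [ev_mul, ev_mul]
  exact mul_nonneg (hl x hx) (mul_self_nonneg _)

theorem eq_zero_of_cellInt_mul_self_eq_zero {q : Poly} (hint : cellInt T (q * q) = 0) : q = 0 :=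
  hT.eq_zero_of_cellInt_mul_mul_self_eq_zero one_ne_zero
    (fun x _ => by rw [ev_one]; exact zero_le_one) (by rwa [one_mul])

theorem cellInt_ddir (t : Pt) (q : Poly) :
    cellInt T (ddir t q) =
      ∑ c ∈ T, ⟪normal T (T.erase c), t⟫_ℝ * ∫ x in hull (T.erase c), ev q x ∂μHE[2] := by
  rw [← hT.setIntegral_fderiv (contDiff_ev q), cellInt_apply]
  simp only [fderiv_ev]

variable {a : Pt}

theorem exists_affine_vanishing_on_face (ha : a ∈ T) :
    ∃ l ∈ P 1, l ≠ 0 ∧ (∀ x ∈ hull (T.erase a), ev l x = 0) ∧ ∀ x ∈ hull T, 0 ≤ ev l x := by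
  set n := normal T (T.erase a)
  have hn : IsOutwardNormal a (T.erase a : Finset Pt) n := hT.isOutwardNormal ha
  obtain ⟨h, hh, hF⟩ := hn.convexHull_base.exists_height
  let l : Poly := MvPolynomial.C (h + ⟪n, a⟫_ℝ) - ∑ j, n j • MvPolynomial.X j
  have hl (x : Pt) : ev l x = h - ⟪n, x - a⟫_ℝ := by
    simp only [l, ev_sub, ev_C, ev_sum, ev_smul, ev_X, inner_sub_right]
    rw [PiLp.inner_apply n x]
    simp only [RCLike.inner_apply, conj_trivial, mul_comm]
    ring
  refine ⟨l, mem_P.2 ?_, fun hl₀ => hh.ne' ?_, fun x hx => by rw [hl, hF x hx, sub_self],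
    fun x hx => ?_⟩
  · refine (MvPolynomial.totalDegree_sub _ _).trans (max_le
      ((MvPolynomial.totalDegree_C _).trans_le zero_le_one) ?_)
    exact mem_P.1 (Submodule.sum_mem _ fun j _ => Submodule.smul_mem _ _ (mem_P.2 (by simp)))
  · simpa [hl₀, ev_zero] using (hl a).symm
  · rw [hl, sub_nonneg]
    refine (IsOutwardNormal.inner_sub_mem_Icc hh.le
      (fun y hy => hF y (subset_convexHull ℝ _ hy)) ?_).2
    rwa [← Finset.coe_insert, Finset.insert_erase ha]

end IsTetrahedron

section WeakGradient

/-- The weak gradient of `u` on the cell `T`, as tested with polynomials of degree at most `k`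
and with the values of `u` on the faces replaced by those of the family `g`, vanishes. -/
def WeakGradientEqZero (k : ℕ) (T : Finset Pt) (u : Poly) (g : Finset Pt → Poly) : Prop :=
  ∀ t : Pt, ∀ q ∈ P k, cellInt T (u * ddir t q) = ∑ c ∈ T,
    ⟪normal T (T.erase c), t⟫_ℝ * ∫ x in hull (T.erase c), ev (g (T.erase c) * q) x ∂μHE[2]

variable {k : ℕ} {T : Finset Pt} {u : Poly} {g : Finset Pt → Poly} {a b : Pt}

namespace WeakGradientEqZero

-- The direction `a - b` is tangential to all faces but those opposite to `a` and `b`.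
theorem cellInt_ddir_sub_mul (h : WeakGradientEqZero k T u g) (hT : IsTetrahedron T)
    (ha : a ∈ T) (hb : b ∈ T) (hab : a ≠ b)
    (hub : ∀ x ∈ hull (T.erase b), ev u x = ev (g (T.erase b)) x) {q : Poly} (hq : q ∈ P k) :
    cellInt T (ddir (a - b) u * q) = ⟪normal T (T.erase a), a - b⟫_ℝ *
      ∫ x in hull (T.erase a), ev ((u - g (T.erase a)) * q) x ∂μHE[2] := by
  have hint {c : Pt} (hc : c ∈ T) (r : Poly) : IntegrableOn (ev r) (hull (T.erase c)) μHE[2] :=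
    hT.integrableOn_hull_erase hc (continuous_ev r)
  have hparts : cellInt T (ddir (a - b) u * q) = ∑ c ∈ T, ⟪normal T (T.erase c), a - b⟫_ℝ *
      ∫ x in hull (T.erase c), ev ((u - g (T.erase c)) * q) x ∂μHE[2] := by
    have hmul : ddir (a - b) u * q = ddir (a - b) (u * q) - u * ddir (a - b) q := by
      rw [Derivation.leibniz, smul_eq_mul, smul_eq_mul]
      ring
    rw [hmul, map_sub, hT.cellInt_ddir, h _ q hq, ← Finset.sum_sub_distrib]
    refine Finset.sum_congr rfl fun c hc => ?_
    rw [← mul_sub, ← integral_sub (hint hc _) (hint hc _)]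
    simp only [sub_mul, ev_sub]
  rw [hparts]
  refine Finset.sum_eq_single_of_mem a ha fun c hc hca => ?_
  rcases eq_or_ne c b with rfl | hcb
  · rw [setIntegral_congr_fun (g := 0) (isCompact_hull _).measurableSet fun x hx => by
      simp only [ev_mul, ev_sub, hub x hx, sub_self, zero_mul, Pi.zero_apply]]
    simp
  · rw [(hT.isOutwardNormal hc).inner_sub_eq_zero (Finset.mem_erase.2 ⟨hca.symm, ha⟩)
      (Finset.mem_erase.2 ⟨hcb.symm, hb⟩), zero_mul]

theorem ddir_sub_eq_zero (h : WeakGradientEqZero k T u g) (hT : IsTetrahedron T) (hu : u ∈ P k)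
    (ha : a ∈ T) (hb : b ∈ T) (hub : ∀ x ∈ hull (T.erase b), ev u x = ev (g (T.erase b)) x) :
    ddir (a - b) u = 0 := by
  rcases eq_or_ne a b with rfl | hab
  · simp
  -- Test with `l * ddir (a - b) u`, where `l` vanishes on the face opposite to `a`.
  obtain ⟨l, hl, hl₀, hlF, hlT⟩ := hT.exists_affine_vanishing_on_face ha
  refine hT.eq_zero_of_cellInt_mul_mul_self_eq_zero hl₀ hlT ?_
  rw [mul_left_comm, h.cellInt_ddir_sub_mul hT ha hb hab hub (mul_ddir_mem_P hl hu _),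
    setIntegral_congr_fun (g := 0) (isCompact_hull _).measurableSet fun x hx => by
      simp only [ev_mul, hlF x hx, zero_mul, mul_zero, Pi.zero_apply]]
  simp

theorem ddir_eq_zero (h : WeakGradientEqZero k T u g) (hT : IsTetrahedron T) (hu : u ∈ P k)
    (hb : b ∈ T) (hub : ∀ x ∈ hull (T.erase b), ev u x = ev (g (T.erase b)) x) (t : Pt) :
    ddir t u = 0 := by
  have ht : t ∈ vectorSpan ℝ (T : Set Pt) := by
    rw [← direction_affineSpan, hT.affineSpan_eq_top, AffineSubspace.direction_top]
    exact Submodule.mem_top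
  rw [vectorSpan_eq_span_vsub_set_right ℝ (Finset.mem_coe.2 hb)] at ht
  induction ht using Submodule.span_induction with
  | mem t ht =>
    obtain ⟨a, ha, rfl⟩ := ht
    exact h.ddir_sub_eq_zero hT hu ha hb hub
  | zero => simp
  | add s t _ _ hs ht => simp [hs, ht]
  | smul r t _ ht => simp [ht]

theorem ev_eq_on_face (h : WeakGradientEqZero k T u g) (hT : IsTetrahedron T) (hu : u ∈ P k)
    (hg : ∀ F, g F ∈ P k) (ha : a ∈ T) (hb : b ∈ T)
    (hub : ∀ x ∈ hull (T.erase b), ev u x = ev (g (T.erase b)) x) :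
    ∀ x ∈ hull (T.erase a), ev u x = ev (g (T.erase a)) x := by
  rcases eq_or_ne a b with rfl | hab
  · exact hub
  have hb' : b ∈ T.erase a := Finset.mem_erase.2 ⟨hab.symm, hb⟩
  obtain ⟨d, hd, hdist⟩ := (hT.isOutwardNormal ha).exists_height
  have hnormal : ⟪normal T (T.erase a), a - b⟫_ℝ ≠ 0 := by
    rw [← neg_sub, inner_neg_right, hdist b hb']
    exact neg_ne_zero.2 hd.ne'
  have hint := h.cellInt_ddir_sub_mul hT ha hb hab hub (Submodule.sub_mem _ hu (hg (T.erase a)))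
  rw [h.ddir_eq_zero hT hu hb hub, zero_mul, map_zero, eq_comm,
    mul_eq_zero_iff_left hnormal] at hint
  intro x hx
  have hsq := hT.eqOn_zero_of_setIntegral_hull_erase_eq_zero ha (continuous_ev _)
    (fun y _ => by rw [ev_mul]; exact mul_self_nonneg _) hint hx
  rwa [ev_mul, Pi.zero_apply, mul_self_eq_zero, ev_sub, sub_eq_zero] at hsq

end WeakGradientEqZero

end WeakGradient

theorem IsTetrahedron.exists_orthogonal_lift {T : Finset Pt} (hT : IsTetrahedron T) {k : ℕ} {b : Pt}
    (hb : b ∈ T) {g : Poly} (hg : g ∈ P k) :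
    ∃ w ∈ P k, (∀ x ∈ hull (T.erase b), ev w x = ev g x) ∧
      ∀ s : Poly, s.totalDegree < k → cellInt T (w * s) = 0 := by
  obtain - | m := k
  · exact ⟨g, hg, fun _ _ => rfl, fun s hs => absurd hs (Nat.not_lt_zero _)⟩
  obtain ⟨l, hl, hl₀, hlF, hlT⟩ := hT.exists_affine_vanishing_on_face hb
  -- Correct `g` by a multiple of `l`, using that `(r, s) ↦ ∫ l r s` is definite.
  let B : P m →ₗ[ℝ] P m →ₗ[ℝ] ℝ :=
    (((LinearMap.mul ℝ Poly).compr₂ (cellInt T)).compl₁₂ (LinearMap.mulLeft ℝ l)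
      LinearMap.id).domRestrict₁₂ (P m) (P m)
  let ℓ : P m →ₗ[ℝ] ℝ := (cellInt T).comp ((LinearMap.mulLeft ℝ g).comp (P m).subtype)
  have hB (r : P m) (hr : B r r = 0) : r = 0 :=
    Subtype.ext (hT.eq_zero_of_cellInt_mul_mul_self_eq_zero hl₀ hlT
      ((congrArg (cellInt T) (mul_assoc l r r)).symm.trans hr))
  obtain ⟨r, hr⟩ := exists_forall_apply_eq_of_definite B ℓ hB
  refine ⟨g - l * r, Submodule.sub_mem _ hg ?_, fun x hx => ?_, fun s hs => ?_⟩
  · simpa only [add_comm] using mul_mem_P hl r.2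
  · rw [ev_sub, ev_mul, hlF x hx, zero_mul, sub_zero]
  · have hrs : cellInt T (l * r * s) = cellInt T (g * s) :=
      hr ⟨s, mem_P.2 (Nat.lt_succ_iff.1 hs)⟩
    rw [sub_mul, map_sub, hrs, sub_self]

theorem cellInt_mul_self_nonneg (T : Finset Pt) (q : Poly) : 0 ≤ cellInt T (q * q) :=
  integral_nonneg fun x => by rw [ev_mul]; exact mul_self_nonneg _

namespace Mesh

variable {Ω : Set Pt} {M : Mesh Ω} {T : M.cells} {F : M.facets}

section FaceIntegral

theorem integrableOn_facet (F : M.facets) {φ : Pt → ℝ} (hφ : Continuous φ) :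
    IntegrableOn φ (hull F) μHE[2] := by
  obtain ⟨T, hT⟩ := exists_mem_facetsOf F
  obtain ⟨a, ha, hF⟩ := exists_eq_erase_of_mem_facetsOf hT
  exact hF ▸ (M.isTetrahedron T).integrableOn_hull_erase ha hφ

/-- The integral of a polynomial over a face of the mesh. -/
noncomputable def faceInt (F : M.facets) : Poly →ₗ[ℝ] ℝ where
  toFun q := ∫ x in hull F, ev q x ∂μHE[2]
  map_add' p q := by
    simp only [ev_add]
    exact integral_add (integrableOn_facet F (continuous_ev p))
      (integrableOn_facet F (continuous_ev q))
  map_smul' c q := by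
    simp only [ev_smul, RingHom.id_apply, smul_eq_mul]
    exact integral_const_mul _ _

theorem faceInt_apply (F : M.facets) (q : Poly) :
    faceInt F q = ∫ x in hull F, ev q x ∂μHE[2] := rfl

theorem faceInt_congr {p q : Poly} (h : ∀ x ∈ hull F, ev p x = ev q x) :
    faceInt F p = faceInt F q :=
  setIntegral_congr_fun (isCompact_hull _).measurableSet h

theorem faceInt_mul_self_nonneg (F : M.facets) (q : Poly) : 0 ≤ faceInt F (q * q) :=
  integral_nonneg fun x => by rw [ev_mul]; exact mul_self_nonneg _

theorem ev_eq_zero_of_faceInt_mul_self_eq_zero {q : Poly} (h : faceInt F (q * q) = 0) :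
    ∀ x ∈ hull F, ev q x = 0 := by
  obtain ⟨T, hT⟩ := exists_mem_facetsOf F
  obtain ⟨a, ha, hF⟩ := exists_eq_erase_of_mem_facetsOf hT
  rw [faceInt_apply, hF] at h
  intro x hx
  have hsq := (M.isTetrahedron T).eqOn_zero_of_setIntegral_hull_erase_eq_zero ha (continuous_ev _)
    (fun y _ => by rw [ev_mul]; exact mul_self_nonneg _) h (hF ▸ hx)
  rwa [ev_mul, Pi.zero_apply, mul_self_eq_zero] at hsq

theorem cellInt_ddir (T : M.cells) (t : Pt) (q : Poly) :
    cellInt T (ddir t q) = ∑ F ∈ M.facetsOf T, ⟪normal T F, t⟫_ℝ * faceInt F q := by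
  rw [(M.isTetrahedron T).cellInt_ddir]
  exact (sum_facetsOf T fun S => ⟪normal T S, t⟫_ℝ * ∫ x in hull S, ev q x ∂μHE[2]).symm

theorem weakGradientEqZero_extend_iff {k : ℕ} {u : Poly} {g : M.facets → Poly} :
    WeakGradientEqZero k T u (Function.extend Subtype.val g 0) ↔ ∀ t : Pt, ∀ q ∈ P k,
      cellInt T (u * ddir t q) =
        ∑ F ∈ M.facetsOf T, ⟪normal T F, t⟫_ℝ * faceInt F (g F * q) := by
  refine forall₃_congr fun t q _ => ?_
  rw [← sum_facetsOf T fun S =>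
    ⟪normal T S, t⟫_ℝ * ∫ x in hull S, ev (Function.extend Subtype.val g 0 S * q) x ∂μHE[2]]
  simp only [Subtype.val_injective.extend_apply, faceInt_apply]

end FaceIntegral

section Forms

variable (M)

/-- Vector polynomials on the faces of the mesh, used to represent the elements of the skeleton
space `M.Tr k`. -/
abbrev PolySkel : Type := M.facets → Fin 3 → Poly

/-- Vector polynomials on the faces of each cell; the two sides of a face may carry different
polynomials. -/
abbrev PolyTrace : Type := M.cells → M.facets → Fin 3 → Poly

/-- `(L, G)` as a bilinear form. -/
noncomputable def formW : M.MatField →ₗ[ℝ] M.MatField →ₗ[ℝ] ℝ :=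
  LinearMap.mk₂ ℝ (fun L G => ∑ T : M.cells, ∑ ij : Fin 3 × Fin 3,
      cellInt T (L T ij.1 ij.2 * G T ij.1 ij.2))
    (by simp [add_mul, Finset.sum_add_distrib]) (by simp [Finset.mul_sum])
    (by simp [mul_add, Finset.sum_add_distrib]) (by simp [Finset.mul_sum])

/-- `(u, v)` as a bilinear form. -/
noncomputable def formV : M.VecField →ₗ[ℝ] M.VecField →ₗ[ℝ] ℝ :=
  LinearMap.mk₂ ℝ (fun u v => ∑ T : M.cells, ∑ i, cellInt T (u T i * v T i))
    (by simp [add_mul, Finset.sum_add_distrib]) (by simp [Finset.mul_sum])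
    (by simp [mul_add, Finset.sum_add_distrib]) (by simp [Finset.mul_sum])

/-- `(p, q)` as a bilinear form. -/
noncomputable def formQ : M.ScalField →ₗ[ℝ] M.ScalField →ₗ[ℝ] ℝ :=
  LinearMap.mk₂ ℝ (fun p q => ∑ T : M.cells, cellInt T (p T * q T))
    (by simp [add_mul, Finset.sum_add_distrib]) (by simp [Finset.mul_sum])
    (by simp [mul_add, Finset.sum_add_distrib]) (by simp [Finset.mul_sum])

/-- The sum `⟪a, b⟫` over the boundaries of the cells as a bilinear form. -/
noncomputable def formBd : M.PolyTrace →ₗ[ℝ] M.PolyTrace →ₗ[ℝ] ℝ :=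
  LinearMap.mk₂ ℝ
    (fun a b => ∑ T : M.cells, ∑ F ∈ M.facetsOf T, ∑ i, faceInt F (a T F i * b T F i))
    (by simp [add_mul, Finset.sum_add_distrib]) (by simp [Finset.mul_sum])
    (by simp [mul_add, Finset.sum_add_distrib]) (by simp [Finset.mul_sum])

/-- The row-wise divergence as a linear map. -/
noncomputable def divL : M.MatField →ₗ[ℝ] M.VecField where
  toFun := M.divW
  map_add' G H := by ext1 T; ext1 i; simp [divW, Finset.sum_add_distrib]
  map_smul' c G := by ext1 T; ext1 i; simp [divW, Finset.smul_sum]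

/-- The gradient as a linear map. -/
noncomputable def gradL : M.ScalField →ₗ[ℝ] M.VecField where
  toFun := M.gradQ
  map_add' p q := by ext1 T; ext1 i; simp [gradQ]
  map_smul' c p := by ext1 T; ext1 i; simp [gradQ]

/-- Polynomial version of `M.ofSkel`. -/
def skelL : M.PolySkel →ₗ[ℝ] M.PolyTrace where
  toFun g _ F i := g F i
  map_add' _ _ := rfl
  map_smul' _ _ := rfl

/-- Polynomial version of `M.trV`. -/
def traceV : M.VecField →ₗ[ℝ] M.PolyTrace where
  toFun v T _ i := v T i
  map_add' _ _ := rfl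
  map_smul' _ _ := rfl

/-- Polynomial version of `M.trW`. -/
noncomputable def traceW : M.MatField →ₗ[ℝ] M.PolyTrace where
  toFun G T F i := ∑ j, normal T F j • G T i j
  map_add' G H := by ext1 T; ext1 F; ext1 i; simp [Finset.sum_add_distrib]
  map_smul' c G := by ext1 T; ext1 F; ext1 i; simp [Finset.smul_sum, smul_comm c]

/-- Polynomial version of `M.trQ`. -/
noncomputable def traceQ : M.ScalField →ₗ[ℝ] M.PolyTrace where
  toFun q T F i := normal T F i • q T
  map_add' p q := by ext1 T; ext1 F; ext1 i; simp
  map_smul' c q := by ext1 T; ext1 F; ext1 i; simp [smul_comm c]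

variable {M}

open Classical in
/-- Multiplication by the stabilization `S`: by `τ` on the distinguished face of each cell and by
zero on its other faces. -/
noncomputable def stabL (star : M.StarChoice) (τ : ℝ) : M.PolyTrace →ₗ[ℝ] M.PolyTrace where
  toFun a T F := (if F = star.face T then τ else 0) • a T F
  map_add' a b := by ext1 T; ext1 F; simp
  map_smul' c a := by ext1 T; ext1 F; simp [smul_comm c]

theorem formV_apply (u v : M.VecField) :
    M.formV u v = ∑ T : M.cells, ∑ i, cellInt T (u T i * v T i) := rfl

theorem formQ_apply (p q : M.ScalField) : M.formQ p q = ∑ T : M.cells, cellInt T (p T * q T) := rfl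

theorem formBd_apply (a b : M.PolyTrace) : M.formBd a b =
    ∑ T : M.cells, ∑ F ∈ M.facetsOf T, ∑ i, faceInt F (a T F i * b T F i) := rfl

theorem divL_apply (G : M.MatField) (T : M.cells) (i : Fin 3) :
    M.divL G T i = ∑ j, dd j (G T i j) := rfl

theorem formV_comm (u v : M.VecField) : M.formV u v = M.formV v u := by
  simp only [formV_apply, mul_comm]

theorem formBd_comm (a b : M.PolyTrace) : M.formBd a b = M.formBd b a := by
  simp only [formBd_apply, mul_comm]

theorem formBd_congr_left {a a' : M.PolyTrace} (b : M.PolyTrace)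
    (h : ∀ T, ∀ F ∈ M.facetsOf T, ∀ x ∈ hull F, ∀ i, ev (a T F i) x = ev (a' T F i) x) :
    M.formBd a b = M.formBd a' b :=
  Finset.sum_congr rfl fun T _ => Finset.sum_congr rfl fun F hF => Finset.sum_congr rfl fun i _ =>
    faceInt_congr fun x hx => by rw [ev_mul, ev_mul, h T F hF x hx]

theorem formBd_stabL (star : M.StarChoice) (τ : ℝ) (a b : M.PolyTrace) :
    M.formBd (stabL star τ a) b = τ * ∑ T : M.cells, ∑ i,
      faceInt (star.face T) (a T (star.face T) i * b T (star.face T) i) := by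
  rw [formBd_apply, Finset.mul_sum]
  refine Finset.sum_congr rfl fun T _ => ?_
  rw [Finset.sum_eq_single_of_mem _ (star.mem T) fun F _ hF => by simp [stabL, hF], Finset.mul_sum]
  exact Finset.sum_congr rfl fun i _ => by simp [stabL]

theorem formW_self_nonneg (L : M.MatField) : 0 ≤ M.formW L L :=
  Finset.sum_nonneg fun _ _ => Finset.sum_nonneg fun _ _ => cellInt_mul_self_nonneg _ _

theorem formQ_self_nonneg (p : M.ScalField) : 0 ≤ M.formQ p p :=
  Finset.sum_nonneg fun _ _ => cellInt_mul_self_nonneg _ _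

theorem formBd_stabL_self_nonneg (star : M.StarChoice) {τ : ℝ} (hτ : 0 ≤ τ) (a : M.PolyTrace) :
    0 ≤ M.formBd (stabL star τ a) a := by
  rw [formBd_stabL]
  exact mul_nonneg hτ
    (Finset.sum_nonneg fun _ _ => Finset.sum_nonneg fun _ _ => faceInt_mul_self_nonneg _ _)

theorem eq_zero_of_formW_self_eq_zero {L : M.MatField} (h : M.formW L L = 0) : L = 0 := by
  ext1 T; ext1 i; ext1 j
  have hT := (Finset.sum_eq_zero_iff_of_nonneg fun T _ => Finset.sum_nonneg fun ij _ =>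
    cellInt_mul_self_nonneg _ _).1 h T (Finset.mem_univ T)
  rw [Finset.sum_eq_zero_iff_of_nonneg fun ij _ => cellInt_mul_self_nonneg _ _] at hT
  exact (M.isTetrahedron T).eq_zero_of_cellInt_mul_self_eq_zero (hT (i, j) (Finset.mem_univ _))

theorem eq_zero_of_formQ_self_eq_zero {p : M.ScalField} (h : M.formQ p p = 0) : p = 0 := by
  ext1 T
  rw [formQ_apply, Finset.sum_eq_zero_iff_of_nonneg fun T _ => cellInt_mul_self_nonneg _ _] at h
  exact (M.isTetrahedron T).eq_zero_of_cellInt_mul_self_eq_zero (h T (Finset.mem_univ T))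

theorem ev_eq_zero_of_formBd_stabL_self_eq_zero {star : M.StarChoice} {τ : ℝ} (hτ : τ ≠ 0)
    {a : M.PolyTrace} (h : M.formBd (stabL star τ a) a = 0) (T : M.cells) (i : Fin 3) :
    ∀ x ∈ hull (star.face T), ev (a T (star.face T) i) x = 0 := by
  rw [formBd_stabL, mul_eq_zero_iff_left hτ, Finset.sum_eq_zero_iff_of_nonneg fun T _ =>
    Finset.sum_nonneg fun i _ => faceInt_mul_self_nonneg _ _] at h
  have hT := h T (Finset.mem_univ T)
  rw [Finset.sum_eq_zero_iff_of_nonneg fun i _ => faceInt_mul_self_nonneg _ _] at hT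
  exact ev_eq_zero_of_faceInt_mul_self_eq_zero (hT i (Finset.mem_univ i))

end Forms

-- With `∂₀(x₀ u²) = u²`, the integral of `u²` becomes a sum of boundary integrals of `x₀ g²`, in
-- which the contributions from the two sides of an interior face cancel.
theorem eq_zero_of_ddir_eq_zero_of_ev_eq {u : M.cells → Poly} {g : M.facets → Poly}
    (hu : ∀ T t, ddir t (u T) = 0)
    (hug : ∀ T, ∀ F ∈ M.facetsOf T, ∀ x ∈ hull F, ev (u T) x = ev (g F) x)
    (hg : ∀ F, M.IsBoundary F → g F = 0) : u = 0 := by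
  classical
  let e : Pt := EuclideanSpace.single 0 1
  let X : Poly := MvPolynomial.X 0
  have hcell (T : M.cells) : cellInt T (u T * u T) =
      ∑ F ∈ M.facetsOf T, ⟪normal T F, e⟫_ℝ * faceInt F (X * (g F * g F)) := by
    have hX : ddir e (X * (u T * u T)) = u T * u T := by
      simp [Derivation.leibniz, hu, X, e, ddir_X]
    rw [← hX, cellInt_ddir]
    refine Finset.sum_congr rfl fun F hF => congrArg _ (faceInt_congr fun x hx => ?_)
    simp only [ev_mul, hug T F hF x hx]
  refine eq_zero_of_formQ_self_eq_zero ?_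
  simp only [formQ_apply, hcell]
  rw [Finset.sum_comm' (t' := Finset.univ)
    (s' := fun F => Finset.univ.filter fun T : M.cells => F ∈ M.facetsOf T) (by simp)]
  refine Finset.sum_eq_zero fun F _ => ?_
  rw [← Finset.sum_mul, ← sum_inner]
  by_cases hF : M.IsBoundary F
  · simp [hg F hF]
  · rw [sum_normal_eq_zero hF, inner_zero_left, zero_mul]


variable {Ω : Set Pt} (M : Mesh Ω)

section Representation

/-- The polynomial representatives of the elements of `M.Tr k`. -/
def skelSpace (k : ℕ) : Submodule ℝ M.PolySkel where
  carrier := {g | ∀ F i, g F i ∈ P k ∧ (M.IsBoundary F → g F i = 0)}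
  add_mem' hg hh F i := ⟨Submodule.add_mem _ (hg F i).1 (hh F i).1, fun hF => by
    rw [Pi.add_apply, Pi.add_apply, (hg F i).2 hF, (hh F i).2 hF, add_zero]⟩
  zero_mem' _ _ := ⟨Submodule.zero_mem _, fun _ => rfl⟩
  smul_mem' c g hg F i := ⟨Submodule.smul_mem _ _ (hg F i).1, fun hF => by
    rw [Pi.smul_apply, Pi.smul_apply, (hg F i).2 hF, smul_zero]⟩

variable {M}

/-- On every face, the skeleton function `lam` is given by the polynomials `g`. -/
def IsRepresentedBy (lam : M.SkelField) (g : M.PolySkel) : Prop :=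
  ∀ F : M.facets, ∀ x ∈ hull F, ∀ i, lam F x i = ev (g F i) x

theorem exists_isRepresentedBy {k : ℕ} {lam : M.SkelField} (h : lam ∈ M.Tr k) :
    ∃ g ∈ M.skelSpace k, IsRepresentedBy lam g := by
  have hface (F : M.facets) : ∃ g : Fin 3 → Poly, (∀ i, g i ∈ P k ∧ (M.IsBoundary F → g i = 0)) ∧
      ∀ x ∈ hull F, ∀ i, lam F x i = ev (g i) x := by
    by_cases hF : M.IsBoundary F
    · refine ⟨0, fun i => ⟨Submodule.zero_mem _, fun _ => rfl⟩, fun x hx i => ?_⟩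
      rw [(h F).2 hF x hx, Pi.zero_apply, Pi.zero_apply, ev_zero]
    · obtain ⟨g, hg, hgx⟩ := (h F).1
      exact ⟨g, fun i => ⟨hg i, fun h => absurd h hF⟩, hgx⟩
  choose g hg hgx using hface
  exact ⟨g, hg, hgx⟩

theorem exists_mem_Tr_isRepresentedBy {k : ℕ} {g : M.PolySkel} (h : g ∈ M.skelSpace k) :
    ∃ lam ∈ M.Tr k, IsRepresentedBy lam g :=
  ⟨fun F x i => ev (g F i) x, fun F => ⟨⟨g F, fun i => (h F i).1, fun _ _ _ => rfl⟩, fun hF x _ =>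
    funext fun i => (congrArg (ev · x) ((h F i).2 hF)).trans (ev_zero x)⟩, fun _ _ _ _ => rfl⟩

theorem innerW_eq_formW (L G : M.MatField) : M.innerW L G = M.formW L G :=
  Finset.sum_congr rfl fun T _ => cellInner_ev (T : Finset Pt)
    (fun ij : Fin 3 × Fin 3 => L T ij.1 ij.2) (fun ij => G T ij.1 ij.2)

theorem innerV_eq_formV (u v : M.VecField) : M.innerV u v = M.formV u v :=
  Finset.sum_congr rfl fun T _ => cellInner_ev (T : Finset Pt) (u T) (v T)

theorem innerQ_eq_formQ (p q : M.ScalField) : M.innerQ p q = M.formQ p q :=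
  Finset.sum_congr rfl fun T _ =>
    (cellInner_ev (T : Finset Pt) (fun _ : Unit => p T) (fun _ => q T)).trans (by simp)

theorem bdInner_eq_formBd {a b : M.cells → M.facets → Pt → Fin 3 → ℝ} {c d : M.PolyTrace}
    (ha : ∀ T, ∀ F : M.facets, ∀ x ∈ hull F, ∀ i, a T F x i = ev (c T F i) x)
    (hb : ∀ T, ∀ F : M.facets, ∀ x ∈ hull F, ∀ i, b T F x i = ev (d T F i) x) :
    M.bdInner a b = M.formBd c d := by
  refine Finset.sum_congr rfl fun T _ => Finset.sum_congr rfl fun F _ => ?_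
  rw [← map_sum, faceInt_apply]
  refine setIntegral_congr_fun (isCompact_hull _).measurableSet fun x hx => ?_
  simp only [ev_sum, ev_mul, ha T F x hx, hb T F x hx]

theorem trW_eq_ev (G : M.MatField) (T : M.cells) (F : M.facets) (x : Pt) (i : Fin 3) :
    M.trW G T F x i = ev (M.traceW G T F i) x := by
  simp [trW, traceW, ev_sum, ev_smul, mul_comm]

theorem trQ_eq_ev (q : M.ScalField) (T : M.cells) (F : M.facets) (x : Pt) (i : Fin 3) :
    M.trQ q T F x i = ev (M.traceQ q T F i) x := by
  simp [trQ, traceQ, ev_smul, mul_comm]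

theorem IsRepresentedBy.stab_eq_ev {lam : M.SkelField} {g : M.PolySkel}
    (h : IsRepresentedBy lam g) (star : M.StarChoice) (τ : ℝ) (u : M.VecField) (T : M.cells)
    (F : M.facets) {x : Pt} (hx : x ∈ hull F) (i : Fin 3) :
    stab star τ u lam T F x i = ev (stabL star τ (M.traceV u - M.skelL g) T F i) x := by
  simp only [stab, stabL, LinearMap.coe_mk, AddHom.coe_mk, h F x hx]
  split_ifs <;> simp [traceV, skelL, ev_smul, ev_sub, ev_zero]

end Representation

section Step

/-- The unknowns `(L, u, p, λ)` of one step, with `λ` represented by polynomials. -/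
abbrev State : Type := M.MatField × M.VecField × M.ScalField × M.PolySkel

/-- The discrete space `W × V × Q × M` of one step. -/
def stateSpace (k : ℕ) : Submodule ℝ M.State where
  carrier := {x | x.1 ∈ M.W k ∧ x.2.1 ∈ M.V k ∧ x.2.2.1 ∈ M.Q k ∧ x.2.2.2 ∈ M.skelSpace k}
  add_mem' hx hy := ⟨fun T i j => Submodule.add_mem _ (hx.1 T i j) (hy.1 T i j),
    fun T i => Submodule.add_mem _ (hx.2.1 T i) (hy.2.1 T i),
    fun T => Submodule.add_mem _ (hx.2.2.1 T) (hy.2.2.1 T),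
    Submodule.add_mem _ hx.2.2.2 hy.2.2.2⟩
  zero_mem' := ⟨fun _ _ _ => Submodule.zero_mem _, fun _ _ => Submodule.zero_mem _,
    fun _ => Submodule.zero_mem _, Submodule.zero_mem _⟩
  smul_mem' _ _ hx := ⟨fun T i j => Submodule.smul_mem _ _ (hx.1 T i j),
    fun T i => Submodule.smul_mem _ _ (hx.2.1 T i),
    fun T => Submodule.smul_mem _ _ (hx.2.2.1 T),
    Submodule.smul_mem _ _ hx.2.2.2⟩

instance finiteDimensional_stateSpace (k : ℕ) : FiniteDimensional ℝ (M.stateSpace k) := by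
  let ι : ((M.cells → Fin 3 → Fin 3 → P k) × (M.cells → Fin 3 → P k) × (M.cells → P k) ×
      (M.facets → Fin 3 → P k)) →ₗ[ℝ] M.State :=
    { toFun := fun x => (fun T i j => x.1 T i j, fun T i => x.2.1 T i, fun T => x.2.2.1 T,
        fun F i => x.2.2.2 F i)
      map_add' := fun _ _ => rfl
      map_smul' := fun _ _ => rfl }
  refine Submodule.finiteDimensional_of_le (S₂ := LinearMap.range ι) fun x hx => ?_
  exact ⟨(fun T i j => ⟨_, hx.1 T i j⟩, fun T i => ⟨_, hx.2.1 T i⟩, fun T => ⟨_, hx.2.2.1 T⟩,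
    fun F i => ⟨_, (hx.2.2.2 F i).1⟩), rfl⟩

/-- The left-hand side of the gradient equation. -/
noncomputable def gradientForm : M.State →ₗ[ℝ] M.MatField →ₗ[ℝ] ℝ :=
  M.formW.coprod <| (M.formV.compl₂ M.divL).coprod <|
    LinearMap.coprod 0 (-M.formBd.compl₁₂ M.skelL M.traceW)

/-- The left-hand side of the pressure equation, with `c` in place of `1 / Δt`. -/
noncomputable def pressureForm (c : ℝ) : M.State →ₗ[ℝ] M.ScalField →ₗ[ℝ] ℝ :=
  LinearMap.coprod 0 <| (-M.formV.compl₂ M.gradL).coprod <|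
    (c • M.formQ).coprod (M.formBd.compl₁₂ M.skelL M.traceQ)

variable {M}

/-- The left-hand side of the momentum equation. -/
noncomputable def momentumForm (star : M.StarChoice) (τ : ℝ) :
    M.State →ₗ[ℝ] M.VecField →ₗ[ℝ] ℝ :=
  (-M.formV ∘ₗ M.divL).coprod <|
    (M.formBd.compl₁₂ (stabL star τ ∘ₗ M.traceV) M.traceV).coprod <|
      (M.formV ∘ₗ M.gradL).coprod (-M.formBd.compl₁₂ (stabL star τ ∘ₗ M.skelL) M.traceV)

/-- The left-hand side of the flux equation. -/
noncomputable def fluxForm (star : M.StarChoice) (τ : ℝ) : M.State →ₗ[ℝ] M.PolySkel →ₗ[ℝ] ℝ :=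
  (-M.formBd.compl₁₂ M.traceW M.skelL).coprod <|
    (M.formBd.compl₁₂ (stabL star τ ∘ₗ M.traceV) M.skelL).coprod <|
      (M.formBd.compl₁₂ M.traceQ M.skelL).coprod
        (-M.formBd.compl₁₂ (stabL star τ ∘ₗ M.skelL) M.skelL)

theorem gradientForm_apply (L : M.MatField) (u : M.VecField) (p : M.ScalField) (g : M.PolySkel)
    (G : M.MatField) : M.gradientForm (L, u, p, g) G =
      M.formW L G + M.formV u (M.divL G) - M.formBd (M.skelL g) (M.traceW G) := by
  simp only [gradientForm, LinearMap.coprod_apply, LinearMap.zero_apply, LinearMap.neg_apply,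
    zero_add, LinearMap.add_apply, LinearMap.compl₂_apply, LinearMap.compl₁₂_apply]
  ring

theorem momentumForm_apply (star : M.StarChoice) (τ : ℝ) (L : M.MatField) (u : M.VecField)
    (p : M.ScalField) (g : M.PolySkel) (v : M.VecField) : momentumForm star τ (L, u, p, g) v =
      M.formV (-M.divL L + M.gradL p) v +
        M.formBd (stabL star τ (M.traceV u - M.skelL g)) (M.traceV v) := by
  simp only [momentumForm, LinearMap.coprod_apply, LinearMap.neg_apply, LinearMap.coe_comp,
    Function.comp_apply, LinearMap.add_apply, LinearMap.compl₁₂_apply, map_add, map_neg, map_sub,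
    LinearMap.sub_apply]
  ring

theorem pressureForm_apply (c : ℝ) (L : M.MatField) (u : M.VecField) (p : M.ScalField)
    (g : M.PolySkel) (q : M.ScalField) : M.pressureForm c (L, u, p, g) q =
      c * M.formQ p q - M.formV u (M.gradL q) + M.formBd (M.skelL g) (M.traceQ q) := by
  simp only [pressureForm, LinearMap.coprod_apply, LinearMap.zero_apply, LinearMap.neg_apply,
    LinearMap.smul_apply, zero_add, LinearMap.add_apply, LinearMap.compl₂_apply, smul_eq_mul,
    LinearMap.compl₁₂_apply]
  ring

theorem fluxForm_apply (star : M.StarChoice) (τ : ℝ) (L : M.MatField) (u : M.VecField)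
    (p : M.ScalField) (g m : M.PolySkel) : fluxForm star τ (L, u, p, g) m =
      M.formBd (-M.traceW L + M.traceQ p + stabL star τ (M.traceV u - M.skelL g)) (M.skelL m) := by
  simp only [fluxForm, LinearMap.coprod_apply, LinearMap.neg_apply, LinearMap.add_apply,
    LinearMap.compl₁₂_apply, LinearMap.coe_comp, Function.comp_apply, map_sub, map_add, map_neg,
    LinearMap.sub_apply]
  ring

/-- One step of the scheme for polynomially represented unknowns, with general right-hand sides
`ℓ` and `r` of the momentum and the pressure equation and `c` in place of `1 / Δt`. -/
structure SolvesPolyStep (star : M.StarChoice) (k : ℕ) (τ c : ℝ) (ℓ : M.VecField → ℝ)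
    (r : M.ScalField → ℝ) (x : M.State) : Prop where
  mem : x ∈ M.stateSpace k
  gradient : ∀ G ∈ M.W k, M.gradientForm x G = 0
  momentum : ∀ v ∈ M.V k, momentumForm star τ x v = ℓ v
  pressure : ∀ q ∈ M.Q k, M.pressureForm c x q = r q
  flux : ∀ m ∈ M.skelSpace k, fluxForm star τ x m = 0

variable {star : M.StarChoice} {k : ℕ} {τ c dt : ℝ} {f : Pt → Pt} {pOld : M.ScalField}
  {L : M.MatField} {u : M.VecField} {p : M.ScalField} {lam : M.SkelField} {g : M.PolySkel}

namespace IsRepresentedBy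

theorem gradientForm_eq (h : IsRepresentedBy lam g) (G : M.MatField) :
    M.gradientForm (L, u, p, g) G =
      M.innerW L G + M.innerV u (M.divW G) - M.bdInner (M.ofSkel lam) (M.trW G) := by
  have hbd : M.bdInner (M.ofSkel lam) (M.trW G) = M.formBd (M.skelL g) (M.traceW G) :=
    bdInner_eq_formBd (fun _ => h) fun T F x _ i => trW_eq_ev G T F x i
  rw [gradientForm_apply, innerW_eq_formW, innerV_eq_formV, hbd]
  rfl

theorem momentumForm_eq (h : IsRepresentedBy lam g) (v : M.VecField) :
    momentumForm star τ (L, u, p, g) v =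
      M.innerV (-M.divW L + M.gradQ p) v + M.bdInner (stab star τ u lam) (M.trV v) := by
  have hbd : M.bdInner (stab star τ u lam) (M.trV v) =
      M.formBd (stabL star τ (M.traceV u - M.skelL g)) (M.traceV v) :=
    bdInner_eq_formBd (fun T F x hx i => h.stab_eq_ev star τ u T F hx i) fun _ _ _ _ _ => rfl
  rw [momentumForm_apply, innerV_eq_formV, hbd]
  rfl

theorem pressureForm_eq (h : IsRepresentedBy lam g) (q : M.ScalField) :
    M.pressureForm c (L, u, p, g) q =
      c * M.innerQ p q - M.innerV u (M.gradQ q) + M.bdInner (M.ofSkel lam) (M.trQ q) := by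
  have hbd : M.bdInner (M.ofSkel lam) (M.trQ q) = M.formBd (M.skelL g) (M.traceQ q) :=
    bdInner_eq_formBd (fun _ => h) fun T F x _ i => trQ_eq_ev q T F x i
  rw [pressureForm_apply, innerQ_eq_formQ, innerV_eq_formV, hbd]
  rfl

theorem fluxForm_eq (h : IsRepresentedBy lam g) {mu : M.SkelField} {m : M.PolySkel}
    (hm : IsRepresentedBy mu m) : fluxForm star τ (L, u, p, g) m =
      M.bdInner (-M.trW L + M.trQ p + stab star τ u lam) (M.ofSkel mu) := by
  rw [fluxForm_apply]
  refine (bdInner_eq_formBd (fun T F x hx i => ?_) fun _ => hm).symm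
  simp only [Pi.add_apply, Pi.neg_apply, ev_add, ev_neg, trW_eq_ev, trQ_eq_ev,
    h.stab_eq_ev star τ u T F hx]

theorem solvesStep_iff (h : IsRepresentedBy lam g) (hlam : lam ∈ M.Tr k) (hg : g ∈ M.skelSpace k) :
    SolvesStep star k τ dt f pOld L u p lam ↔
      SolvesPolyStep star k τ (1 / dt) (M.load f) (fun q => 1 / dt * M.innerQ pOld q)
        (L, u, p, g) where
  mp hs :=
    { mem := ⟨hs.L_mem, hs.u_mem, hs.p_mem, hg⟩
      gradient G hG := h.gradientForm_eq G ▸ hs.eq_gradient G hG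
      momentum v hv := h.momentumForm_eq v ▸ hs.eq_momentum v hv
      pressure q hq := h.pressureForm_eq q ▸ hs.eq_pressure q hq
      flux m hm := by
        obtain ⟨mu, hmu, hrep⟩ := exists_mem_Tr_isRepresentedBy hm
        exact h.fluxForm_eq hrep ▸ hs.eq_flux mu hmu }
  mpr hs :=
    { L_mem := hs.mem.1
      u_mem := hs.mem.2.1
      p_mem := hs.mem.2.2.1
      lam_mem := hlam
      eq_gradient G hG := h.gradientForm_eq G ▸ hs.gradient G hG
      eq_momentum v hv := h.momentumForm_eq v ▸ hs.momentum v hv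
      eq_pressure q hq := h.pressureForm_eq q ▸ hs.pressure q hq
      eq_flux mu hmu := by
        obtain ⟨m, hm, hrep⟩ := exists_isRepresentedBy hmu
        exact h.fluxForm_eq hrep ▸ hs.flux m hm }

end IsRepresentedBy

end Step

end Mesh

section Moments

variable {T : Finset Pt} {φ : Pt → ℝ}

theorem integrableOn_mul_ev (hφ : IntegrableOn φ (hull T)) (q : Poly) :
    IntegrableOn (fun x => φ x * ev q x) (hull T) :=
  hφ.mul_continuousOn (continuous_ev q).continuousOn (isCompact_hull T)

/-- The moments `q ↦ (φ, q)` over a tetrahedron of an integrable function `φ`. -/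
noncomputable def momentL (hφ : IntegrableOn φ (hull T)) : Poly →ₗ[ℝ] ℝ where
  toFun q := ∫ x in hull T, φ x * ev q x
  map_add' p q := by
    simp only [ev_add, mul_add]
    exact integral_add (integrableOn_mul_ev hφ p) (integrableOn_mul_ev hφ q)
  map_smul' c q := by
    simp only [ev_smul, mul_left_comm]
    exact integral_const_mul _ _

theorem momentL_apply (hφ : IntegrableOn φ (hull T)) (q : Poly) :
    momentL hφ q = ∫ x in hull T, φ x * ev q x := rfl

end Moments

namespace Mesh

variable {Ω : Set Pt} {M : Mesh Ω} {star : M.StarChoice} {k : ℕ} {τ c dt : ℝ}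

section HomogeneousStep

/-- The bilinear form of one step: the gradient, momentum and pressure equations minus the flux
equation, the sign for which the coupling terms cancel when a state is tested with itself. -/
noncomputable def stepForm (star : M.StarChoice) (τ c : ℝ) : M.State →ₗ[ℝ] M.State →ₗ[ℝ] ℝ :=
  M.gradientForm.compl₂ (.fst ℝ _ _) + (momentumForm star τ).compl₂ (.fst ℝ _ _ ∘ₗ .snd ℝ _ _) +
    (M.pressureForm c).compl₂ (.fst ℝ _ _ ∘ₗ .snd ℝ _ _ ∘ₗ .snd ℝ _ _) -
    (fluxForm star τ).compl₂ (.snd ℝ _ _ ∘ₗ .snd ℝ _ _ ∘ₗ .snd ℝ _ _)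

theorem stepForm_apply (x : M.State) (G : M.MatField) (v : M.VecField) (q : M.ScalField)
    (m : M.PolySkel) : stepForm star τ c x (G, v, q, m) =
      M.gradientForm x G + momentumForm star τ x v + M.pressureForm c x q - fluxForm star τ x m :=
  rfl

theorem stepForm_self (L : M.MatField) (u : M.VecField) (p : M.ScalField) (g : M.PolySkel) :
    stepForm star τ c (L, u, p, g) (L, u, p, g) = M.formW L L + c * M.formQ p p +
      M.formBd (stabL star τ (M.traceV u - M.skelL g)) (M.traceV u - M.skelL g) := by
  simp only [stepForm_apply, gradientForm_apply, momentumForm_apply, pressureForm_apply,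
    fluxForm_apply, map_add, map_neg, map_sub, LinearMap.add_apply, LinearMap.neg_apply,
    LinearMap.sub_apply]
  rw [formV_comm u (M.divL L), formV_comm u (M.gradL p), formBd_comm (M.skelL g) (M.traceW L),
    formBd_comm (M.skelL g) (M.traceQ p)]
  ring

theorem solvesPolyStep_iff_stepForm {ℓ : M.VecField →ₗ[ℝ] ℝ} {r : M.ScalField →ₗ[ℝ] ℝ}
    {x : M.State} : SolvesPolyStep star k τ c ℓ r x ↔ x ∈ M.stateSpace k ∧
      ∀ y ∈ M.stateSpace k, stepForm star τ c x y = ℓ y.2.1 + r y.2.2.1 where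
  mp h := by
    refine ⟨h.mem, fun ⟨G, v, q, m⟩ hy => ?_⟩
    rw [stepForm_apply, h.gradient G hy.1, h.momentum v hy.2.1, h.pressure q hy.2.2.1,
      h.flux m hy.2.2.2, zero_add, sub_zero]
  mpr := by
    rintro ⟨hx, h⟩
    have hV : (0 : M.VecField) ∈ M.V k := fun _ _ => Submodule.zero_mem _
    have hQ : (0 : M.ScalField) ∈ M.Q k := fun _ => Submodule.zero_mem _
    have hW : (0 : M.MatField) ∈ M.W k := fun _ _ _ => Submodule.zero_mem _
    have hM := Submodule.zero_mem (M.skelSpace k)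
    exact
      { mem := hx
        gradient := fun G hG => by simpa [stepForm_apply] using h (G, 0, 0, 0) ⟨hG, hV, hQ, hM⟩
        momentum := fun v hv => by simpa [stepForm_apply] using h (0, v, 0, 0) ⟨hW, hv, hQ, hM⟩
        pressure := fun q hq => by simpa [stepForm_apply] using h (0, 0, q, 0) ⟨hW, hV, hq, hM⟩
        flux := fun m hm => by simpa [stepForm_apply] using h (0, 0, 0, m) ⟨hW, hV, hQ, hm⟩ }

theorem SolvesPolyStep.sub {ℓ : M.VecField → ℝ} {r : M.ScalField → ℝ} {x y : M.State}
    (hx : SolvesPolyStep star k τ c ℓ r x) (hy : SolvesPolyStep star k τ c ℓ r y) :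
    SolvesPolyStep star k τ c 0 0 (x - y) where
  mem := Submodule.sub_mem _ hx.mem hy.mem
  gradient G hG := by
    rw [map_sub, LinearMap.sub_apply, hx.gradient G hG, hy.gradient G hG, sub_self]
  momentum v hv := by
    rw [map_sub, LinearMap.sub_apply, hx.momentum v hv, hy.momentum v hv, sub_self, Pi.zero_apply]
  pressure q hq := by
    rw [map_sub, LinearMap.sub_apply, hx.pressure q hq, hy.pressure q hq, sub_self, Pi.zero_apply]
  flux m hm := by rw [map_sub, LinearMap.sub_apply, hx.flux m hm, hy.flux m hm, sub_self]

open Classical in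
theorem formV_divL_single (u : M.VecField) (T : M.cells) (i : Fin 3) (t : Pt) (q : Poly) :
    M.formV u (M.divL (Pi.single T (Pi.single i fun j => t j • q))) =
      cellInt T (u T i * ddir t q) := by
  have hdiv : M.divL (Pi.single T (Pi.single i fun j => t j • q)) =
      Pi.single T (Pi.single i (ddir t q)) := by
    ext1 T'; ext1 i'
    obtain rfl | hT := eq_or_ne T' T
    · obtain rfl | hi := eq_or_ne i' i
      · simp [divL_apply, ddir_apply]
      · simp [divL_apply, hi]
    · simp [divL_apply, hT]
  rw [hdiv, formV_apply, Fintype.sum_eq_single T fun T' hT => by simp [hT],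
    Fintype.sum_eq_single i fun i' hi => by simp [hi], Pi.single_eq_same, Pi.single_eq_same]

open Classical in
theorem formBd_traceW_single (g : M.PolySkel) (T : M.cells) (i : Fin 3) (t : Pt) (q : Poly) :
    M.formBd (M.skelL g) (M.traceW (Pi.single T (Pi.single i fun j => t j • q))) =
      ∑ F ∈ M.facetsOf T, ⟪normal T F, t⟫_ℝ * faceInt F (g F i * q) := by
  have hnormal (F : M.facets) : M.traceW (Pi.single T (Pi.single i fun j => t j • q)) T F i =
      ⟪normal T F, t⟫_ℝ • q := by
    simp [traceW, smul_smul, ← Finset.sum_smul, PiLp.inner_apply, mul_comm]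
  rw [formBd_apply, Fintype.sum_eq_single T fun T' hT => by simp [traceW, hT]]
  refine Finset.sum_congr rfl fun F _ => ?_
  rw [Fintype.sum_eq_single i fun i' hi => by simp [traceW, hi], hnormal, mul_smul_comm, map_smul,
    smul_eq_mul]
  rfl

theorem weakGradientEqZero_of_gradientForm {u : M.VecField} {p : M.ScalField} {g : M.PolySkel}
    (h : ∀ G ∈ M.W k, M.gradientForm (0, u, p, g) G = 0) (T : M.cells) (i : Fin 3) :
    WeakGradientEqZero k T (u T i) (Function.extend Subtype.val (g · i) 0) := by
  classical
  refine weakGradientEqZero_extend_iff.2 fun t q hq => ?_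
  have hmem : Pi.single T (Pi.single i fun j => t j • q) ∈ M.W k := fun T' i' j => by
    obtain rfl | hT := eq_or_ne T' T
    · obtain rfl | hi := eq_or_ne i' i
      · simpa only [Pi.single_eq_same] using Submodule.smul_mem _ _ hq
      · simp [hi]
    · simp [hT]
  have htest := h _ hmem
  rwa [gradientForm_apply, map_zero, LinearMap.zero_apply, zero_add, formV_divL_single,
    formBd_traceW_single, sub_eq_zero] at htest

theorem ev_eq_on_facet_of_weakGradientEqZero {T : M.cells} {u : Poly} {g : M.facets → Poly}
    (h : WeakGradientEqZero k T u (Function.extend Subtype.val g 0)) (hu : u ∈ P k)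
    (hg : ∀ F, g F ∈ P k) (hstar : ∀ x ∈ hull (star.face T), ev u x = ev (g (star.face T)) x) :
    (∀ t, ddir t u = 0) ∧ ∀ F ∈ M.facetsOf T, ∀ x ∈ hull F, ev u x = ev (g F) x := by
  obtain ⟨b, hb, hFb⟩ := exists_eq_erase_of_mem_facetsOf (star.mem T)
  have hgext (F : M.facets) : Function.extend Subtype.val g 0 (F : Finset Pt) = g F :=
    Subtype.val_injective.extend_apply _ _ _
  have hub : ∀ x ∈ hull ((T : Finset Pt).erase b),
      ev u x = ev (Function.extend Subtype.val g 0 ((T : Finset Pt).erase b)) x := by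
    rwa [← hFb, hgext]
  have hgP (S : Finset Pt) : Function.extend Subtype.val g 0 S ∈ P k := by
    by_cases hS : ∃ F : M.facets, F = S
    · obtain ⟨F, rfl⟩ := hS
      exact (hgext F).symm ▸ hg F
    · rw [Function.extend_apply' _ _ _ hS]
      exact Submodule.zero_mem _
  refine ⟨h.ddir_eq_zero (M.isTetrahedron T) hu hb hub, fun F hF x hx => ?_⟩
  obtain ⟨a, ha, hFa⟩ := exists_eq_erase_of_mem_facetsOf hF
  have hua := h.ev_eq_on_face (M.isTetrahedron T) hu hgP ha hb hub
  rw [← hFa, hgext] at hua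
  exact hua x hx

theorem SolvesPolyStep.eq_zero {L : M.MatField} {u : M.VecField} {p : M.ScalField} {g : M.PolySkel}
    (hτ : 0 < τ) (hc : 0 < c) (h : SolvesPolyStep star k τ c 0 0 (L, u, p, g)) :
    L = 0 ∧ u = 0 ∧ p = 0 ∧ ∀ F : M.facets, ∀ x ∈ hull F, ∀ i, ev (g F i) x = 0 := by
  set a := M.traceV u - M.skelL g
  have henergy : M.formW L L + c * M.formQ p p + M.formBd (stabL star τ a) a = 0 := by
    rw [← stepForm_self, stepForm_apply, h.gradient L h.mem.1, h.momentum u h.mem.2.1,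
      h.pressure p h.mem.2.2.1, h.flux g h.mem.2.2.2]
    simp
  have hL_nonneg := formW_self_nonneg L
  have hp_nonneg := mul_nonneg hc.le (formQ_self_nonneg p)
  have ha_nonneg := formBd_stabL_self_nonneg star hτ.le a
  obtain rfl : L = 0 := eq_zero_of_formW_self_eq_zero (by linarith)
  have hp : p = 0 := eq_zero_of_formQ_self_eq_zero <|
    (mul_eq_zero_iff_left hc.ne').1 (by linarith : c * M.formQ p p = 0)
  have hstar (T i) : ∀ x ∈ hull (star.face T), ev (u T i) x = ev (g (star.face T) i) x := by
    intro x hx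
    rw [← sub_eq_zero, ← ev_sub]
    exact ev_eq_zero_of_formBd_stabL_self_eq_zero hτ.ne' (by linarith) T i x hx
  have hlocal (T i) := ev_eq_on_facet_of_weakGradientEqZero
    (weakGradientEqZero_of_gradientForm h.gradient T i) (h.mem.2.1 T i)
    (fun F => (h.mem.2.2.2 F i).1) (hstar T i)
  have hu (T i) : u T i = 0 := congrFun (eq_zero_of_ddir_eq_zero_of_ev_eq (u := (u · i))
    (fun T => (hlocal T i).1) (fun T => (hlocal T i).2) fun F => (h.mem.2.2.2 F i).2) T
  refine ⟨rfl, funext fun T => funext (hu T), hp, fun F x hx i => ?_⟩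
  obtain ⟨T, hT⟩ := exists_mem_facetsOf F
  rw [← (hlocal T i).2 F hT x hx, hu, ev_zero]

end HomogeneousStep

section Solvability

variable {f : Pt → Pt} {pOld : M.ScalField}

theorem SolvesPolyStep.unique {ℓ : M.VecField → ℝ} {r : M.ScalField → ℝ} {L L' : M.MatField}
    {u u' : M.VecField} {p p' : M.ScalField} {g g' : M.PolySkel} (hτ : 0 < τ) (hc : 0 < c)
    (h : SolvesPolyStep star k τ c ℓ r (L, u, p, g))
    (h' : SolvesPolyStep star k τ c ℓ r (L', u', p', g')) :
    L = L' ∧ u = u' ∧ p = p' ∧ ∀ F : M.facets, ∀ x ∈ hull F, ∀ i, ev (g F i) x = ev (g' F i) x := by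
  obtain ⟨hL, hu, hp, hg⟩ := (h.sub h').eq_zero hτ hc
  refine ⟨sub_eq_zero.1 hL, sub_eq_zero.1 hu, sub_eq_zero.1 hp, fun F x hx i => ?_⟩
  rw [← sub_eq_zero, ← ev_sub]
  exact hg F x hx i

theorem stepForm_eq_zero_of_ev_eq_zero (x : M.State) {g : M.PolySkel}
    (hg : ∀ F : M.facets, ∀ y ∈ hull F, ∀ i, ev (g F i) y = 0) :
    stepForm star τ c x (0, 0, 0, g) = 0 := by
  obtain ⟨L, u, p, g'⟩ := x
  have hflux (a : M.PolyTrace) : M.formBd a (M.skelL g) = 0 := by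
    have hzero : M.formBd (M.skelL g) a = M.formBd 0 a :=
      formBd_congr_left a fun T F _ y hy i => (hg F y hy i).trans (ev_zero y).symm
    rw [formBd_comm, hzero, map_zero, LinearMap.zero_apply]
  simp [stepForm_apply, fluxForm_apply, hflux]

theorem exists_solvesPolyStep (star : M.StarChoice) (k : ℕ) (hτ : 0 < τ) (hc : 0 < c)
    (ℓ : M.VecField →ₗ[ℝ] ℝ) (r : M.ScalField →ₗ[ℝ] ℝ) :
    ∃ x, SolvesPolyStep star k τ c ℓ r x := by
  let B := (stepForm star τ c).domRestrict₁₂ (M.stateSpace k) (M.stateSpace k)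
  let rhs : M.State →ₗ[ℝ] ℝ :=
    ℓ ∘ₗ .fst ℝ _ _ ∘ₗ .snd ℝ _ _ + r ∘ₗ .fst ℝ _ _ ∘ₗ .snd ℝ _ _ ∘ₗ .snd ℝ _ _
  have hker (x) (hx : x ∈ LinearMap.ker B) : ∃ g : M.PolySkel,
      x.1 = (0, 0, 0, g) ∧ ∀ F : M.facets, ∀ y ∈ hull F, ∀ i, ev (g F i) y = 0 := by
    obtain ⟨⟨L, u, p, g⟩, hmem⟩ := x
    have hsol : SolvesPolyStep star k τ c (0 : M.VecField →ₗ[ℝ] ℝ) (0 : M.ScalField →ₗ[ℝ] ℝ)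
        (L, u, p, g) :=
      solvesPolyStep_iff_stepForm.2 ⟨hmem, fun y hy =>
        (LinearMap.congr_fun hx ⟨y, hy⟩).trans (add_zero 0).symm⟩
    obtain ⟨rfl, rfl, rfl, hg⟩ := SolvesPolyStep.eq_zero hτ hc hsol
    exact ⟨g, rfl, hg⟩
  obtain ⟨x, hx⟩ := exists_forall_apply_eq_of_ker B (rhs ∘ₗ (M.stateSpace k).subtype)
    (fun x hx y => by
      obtain ⟨g, hxg, hg⟩ := hker x hx
      change stepForm star τ c y.1 x.1 = 0
      rw [hxg, stepForm_eq_zero_of_ev_eq_zero _ hg])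
    (fun x hx => by
      obtain ⟨g, hxg, -⟩ := hker x hx
      change rhs x.1 = 0
      simp [rhs, hxg])
  exact ⟨x, solvesPolyStep_iff_stepForm.2 ⟨x.2, fun y hy => hx ⟨y, hy⟩⟩⟩

theorem exists_linearMap_eq_load (hf : ∀ T : M.cells, IntegrableOn f (hull T)) :
    ∃ ℓ : M.VecField →ₗ[ℝ] ℝ, ⇑ℓ = M.load f := by
  have hfi (T : M.cells) (i : Fin 3) : IntegrableOn (f · i) (hull T) :=
    (EuclideanSpace.proj i : Pt →L[ℝ] ℝ).integrable_comp (hf T)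
  refine ⟨∑ T : M.cells, ∑ i, momentL (hfi T i) ∘ₗ .proj i ∘ₗ .proj T, funext fun v => ?_⟩
  simp only [LinearMap.sum_apply, LinearMap.comp_apply, LinearMap.proj_apply, momentL_apply]
  exact Finset.sum_congr rfl fun T _ =>
    (integral_finsetSum _ fun i _ => integrableOn_mul_ev (hfi T i) _).symm

theorem exists_solvesStep (star : M.StarChoice) (k : ℕ) (hτ : 0 < τ) (hdt : 0 < dt)
    (hf : ∀ T : M.cells, IntegrableOn f (hull T)) (pOld : M.ScalField) :
    ∃ L u p lam, SolvesStep star k τ dt f pOld L u p lam := by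
  obtain ⟨ℓ, hℓ⟩ := exists_linearMap_eq_load hf
  obtain ⟨⟨L, u, p, g⟩, h⟩ := exists_solvesPolyStep star k hτ (one_div_pos.2 hdt) ℓ
    ((1 / dt) • M.formQ pOld)
  obtain ⟨lam, hlam, hg⟩ := exists_mem_Tr_isRepresentedBy h.mem.2.2.2
  refine ⟨L, u, p, lam, (hg.solvesStep_iff hlam h.mem.2.2.2).2 ?_⟩
  rw [← hℓ]
  simp only [innerQ_eq_formQ]
  exact h

theorem exists_innerQ_eq_loadQ (k : ℕ) {p₀ : Pt → ℝ}
    (hp₀ : ∀ T : M.cells, IntegrableOn p₀ (hull T)) :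
    ∃ p ∈ M.Q k, ∀ q ∈ M.Q k, M.innerQ p q = M.loadQ p₀ q := by
  have hcell (T : M.cells) : ∃ r : P k, ∀ s : P k, cellInt T (r * s) = momentL (hp₀ T) s :=
    exists_forall_apply_eq_of_definite
      (((LinearMap.mul ℝ Poly).compr₂ (cellInt T)).domRestrict₁₂ (P k) (P k))
      (momentL (hp₀ T) ∘ₗ (P k).subtype)
      fun _ h => Subtype.ext ((M.isTetrahedron T).eq_zero_of_cellInt_mul_self_eq_zero h)
  choose r hr using hcell
  refine ⟨fun T => r T, fun T => (r T).2, fun q hq => ?_⟩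
  rw [innerQ_eq_formQ]
  refine Finset.sum_congr rfl fun T _ => (hr T ⟨q T, hq T⟩).trans ?_
  simp [momentL_apply, cellInner]

theorem eq_of_innerQ_eq {p p' : M.ScalField} (hp : p ∈ M.Q k) (hp' : p' ∈ M.Q k)
    (h : ∀ q ∈ M.Q k, M.innerQ p q = M.innerQ p' q) : p = p' := by
  have hself := h (p - p') fun T => Submodule.sub_mem _ (hp T) (hp' T)
  rw [innerQ_eq_formQ, innerQ_eq_formQ, ← sub_eq_zero, ← LinearMap.sub_apply, ← map_sub] at hself
  exact sub_eq_zero.1 (eq_zero_of_formQ_self_eq_zero hself)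

theorem exists_isIteration (star : M.StarChoice) (k : ℕ) (hτ : 0 < τ) (hdt : 0 < dt)
    {p₀ : Pt → ℝ} (hf : ∀ T : M.cells, IntegrableOn f (hull T))
    (hp₀ : ∀ T : M.cells, IntegrableOn p₀ (hull T)) :
    ∃ L u p lam, IsIteration star k τ dt f p₀ L u p lam := by
  obtain ⟨pInit, hmem, heq⟩ := exists_innerQ_eq_loadQ k hp₀
  choose L u p lam hstep using exists_solvesStep star k hτ hdt hf
  let pSeq (n : ℕ) : M.ScalField := p^[n] pInit
  refine ⟨fun n => L (pSeq (n - 1)), fun n => u (pSeq (n - 1)), pSeq,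
    fun n => lam (pSeq (n - 1)), hmem, heq, fun n => ?_⟩
  rw [show pSeq (n + 1) = p (pSeq n) from Function.iterate_succ_apply' _ _ _]
  exact hstep (pSeq n)

end Solvability


variable {Ω : Set Pt} {M : Mesh Ω} {star : M.StarChoice} {k : ℕ} {τ τ₁ τ₂ c dt : ℝ}

section TopDegree

/-- The fields which on every cell are orthogonal to `[P_{k-1}]³`, with `P_{-1} = {0}`. -/
def OrthLower (k : ℕ) (w : M.VecField) : Prop :=
  ∀ T : M.cells, ∀ i, ∀ s : Poly, s.totalDegree < k → cellInt T (w T i * s) = 0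

namespace OrthLower

variable {w : M.VecField}

theorem cellInt_mul_dd (hw : OrthLower k w) {q : Poly} (hq : q ∈ P k) (T : M.cells) (i j : Fin 3) :
    cellInt T (w T i * dd j q) = 0 := by
  rw [← ddir_single]
  obtain rfl | hk := k.eq_zero_or_pos
  · rw [ddir_eq_zero_of_mem_P_zero hq, mul_zero, map_zero]
  · exact hw T i _ ((mem_P.1 (ddir_mem_P hq _)).trans_lt (Nat.sub_lt hk one_pos))

theorem formV_divL (hw : OrthLower k w) {G : M.MatField} (hG : G ∈ M.W k) :
    M.formV w (M.divL G) = 0 :=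
  Finset.sum_eq_zero fun T _ => Finset.sum_eq_zero fun i _ => by
    rw [divL_apply, Finset.mul_sum, map_sum]
    exact Finset.sum_eq_zero fun j _ => hw.cellInt_mul_dd (hG T i j) T i j

theorem formV_gradL (hw : OrthLower k w) {q : M.ScalField} (hq : q ∈ M.Q k) :
    M.formV w (M.gradL q) = 0 :=
  Finset.sum_eq_zero fun T _ => Finset.sum_eq_zero fun i _ => hw.cellInt_mul_dd (hq T) T i i

end OrthLower

theorem exists_orthLower_ev_eq (star : M.StarChoice) {v : M.VecField} (hv : v ∈ M.V k) :
    ∃ w ∈ M.V k, OrthLower k w ∧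
      ∀ T i, ∀ x ∈ hull (star.face T), ev (w T i) x = ev (v T i) x := by
  have hlift (T : M.cells) (i : Fin 3) : ∃ w ∈ P k,
      (∀ x ∈ hull (star.face T), ev w x = ev (v T i) x) ∧
        ∀ s : Poly, s.totalDegree < k → cellInt T (w * s) = 0 := by
    obtain ⟨b, hb, hFb⟩ := exists_eq_erase_of_mem_facetsOf (star.mem T)
    rw [hFb]
    exact (M.isTetrahedron T).exists_orthogonal_lift hb (hv T i)
  choose w hw hwF hworth using hlift
  exact ⟨w, hw, hworth, hwF⟩

theorem formBd_stabL_congr_left {a a' : M.PolyTrace} (b : M.PolyTrace)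
    (h : ∀ T i, ∀ x ∈ hull (star.face T),
      τ₁ * ev (a T (star.face T) i) x = τ₂ * ev (a' T (star.face T) i) x) :
    M.formBd (stabL star τ₁ a) b = M.formBd (stabL star τ₂ a') b := by
  rw [formBd_stabL, formBd_stabL, Finset.mul_sum, Finset.mul_sum]
  refine Finset.sum_congr rfl fun T _ => ?_
  rw [Finset.mul_sum, Finset.mul_sum]
  refine Finset.sum_congr rfl fun i _ => ?_
  have hface : faceInt (star.face T) (τ₁ • (a T (star.face T) i * b T (star.face T) i)) =
      faceInt (star.face T) (τ₂ • (a' T (star.face T) i * b T (star.face T) i)) :=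
    faceInt_congr fun x hx => by
      rw [ev_smul, ev_smul, ev_mul, ev_mul, ← mul_assoc, ← mul_assoc, h T i x hx]
  rwa [map_smul, map_smul, smul_eq_mul, smul_eq_mul] at hface

theorem formBd_stabL_congr_right {a b b' : M.PolyTrace}
    (h : ∀ T i, ∀ x ∈ hull (star.face T),
      ev (b T (star.face T) i) x = ev (b' T (star.face T) i) x) :
    M.formBd (stabL star τ a) b = M.formBd (stabL star τ a) b' := by
  rw [formBd_stabL, formBd_stabL]
  refine congrArg _ (Finset.sum_congr rfl fun T _ => Finset.sum_congr rfl fun i _ => ?_)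
  exact faceInt_congr fun x hx => by rw [ev_mul, ev_mul, h T i x hx]

variable (M) in
/-- The functional `ℓ` vanishes on the fields of degree `k` which are orthogonal to `[P_{k-1}]³` on
every cell; for `ℓ = (f, ·)` this is `M.NoTopDegree k f`. -/
def VanishesOnTop (k : ℕ) (ℓ : M.VecField → ℝ) : Prop :=
  ∀ v ∈ M.V k, OrthLower k v → ℓ v = 0

open Classical in
theorem mem_V_single {T : M.cells} {v : Fin 3 → Poly} (hv : ∀ i, v i ∈ P k) :
    Pi.single T v ∈ M.V k := fun T' i => by
  obtain rfl | hT := eq_or_ne T' T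
  · simpa only [Pi.single_eq_same] using hv i
  · simp [hT]

open Classical in
theorem orthLower_single {T : M.cells} {v : Fin 3 → Poly}
    (h : ∀ w : Fin 3 → Poly, (∀ i, (w i).totalDegree < k) →
      cellInner T (fun i => ev (v i)) (fun i => ev (w i)) = 0) :
    OrthLower k (Pi.single T v : M.VecField) := fun T' i s hs => by
  obtain rfl | hT := eq_or_ne T' T
  · have htest := h (Pi.single i s) fun i' => by
      obtain rfl | hi := eq_or_ne i' i
      · simpa only [Pi.single_eq_same] using hs
      · simpa [hi] using hs.pos
    rw [cellInner_ev, Fintype.sum_eq_single i fun i' hi => by simp [hi]] at htest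
    simpa only [Pi.single_eq_same] using htest
  · simp [hT]

theorem noTopDegree_iff_vanishesOnTop {f : Pt → Pt} :
    M.NoTopDegree k f ↔ M.VanishesOnTop k (M.load f) := by
  classical
  refine ⟨fun h v hv hvo => Finset.sum_eq_zero fun T _ => h T (v T) (hv T) fun w hw => ?_,
    fun h T v hv hvo => ?_⟩
  · rw [cellInner_ev]
    exact Finset.sum_eq_zero fun i _ => hvo T i _ (hw i)
  · have hload := h (Pi.single T v) (mem_V_single hv) (orthLower_single hvo)
    rw [load, Fintype.sum_eq_single T fun T' hT => by simp [cellInner, hT, ev_zero]] at hload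
    simpa only [Pi.single_eq_same] using hload

end TopDegree

section ParameterDependence

variable {ℓ : M.VecField → ℝ} {r : M.ScalField → ℝ} {L L₁ L₂ : M.MatField} {u u₁ u₂ : M.VecField}
  {p p₁ p₂ : M.ScalField} {g g₁ g₂ : M.PolySkel}

namespace SolvesPolyStep

theorem add_orthLower (h : SolvesPolyStep star k τ₁ c ℓ r (L, u, p, g)) {w : M.VecField}
    (hwk : w ∈ M.V k) (hw : OrthLower k w)
    (hstar : ∀ T i, ∀ x ∈ hull (star.face T),
      τ₂ * ev (u T i + w T i - g (star.face T) i) x = τ₁ * ev (u T i - g (star.face T) i) x) :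
    SolvesPolyStep star k τ₂ c ℓ r (L, u + w, p, g) := by
  have hstab (b : M.PolyTrace) : M.formBd (stabL star τ₂ (M.traceV (u + w) - M.skelL g)) b =
      M.formBd (stabL star τ₁ (M.traceV u - M.skelL g)) b :=
    formBd_stabL_congr_left b hstar
  refine ⟨⟨h.mem.1, fun T i => Submodule.add_mem _ (h.mem.2.1 T i) (hwk T i), h.mem.2.2⟩,
    fun G hG => ?_, fun v hv => ?_, fun q hq => ?_, fun m hm => ?_⟩
  · rw [← h.gradient G hG, gradientForm_apply, gradientForm_apply, map_add, LinearMap.add_apply,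
      hw.formV_divL hG, add_zero]
  · rw [← h.momentum v hv, momentumForm_apply, momentumForm_apply, hstab]
  · rw [← h.pressure q hq, pressureForm_apply, pressureForm_apply, map_add, LinearMap.add_apply,
      hw.formV_gradL hq, add_zero]
  · rw [← h.flux m hm, fluxForm_apply, fluxForm_apply, map_add M.formBd,
      LinearMap.add_apply, hstab, ← LinearMap.add_apply, ← map_add]

theorem exists_of_ne_zero (h : SolvesPolyStep star k τ₁ c ℓ r (L, u, p, g)) (hτ₂ : τ₂ ≠ 0) :
    ∃ u', SolvesPolyStep star k τ₂ c ℓ r (L, u', p, g) := by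
  obtain ⟨w, hwk, hw, hwF⟩ := exists_orthLower_ev_eq star (k := k)
    (v := fun T i => ((τ₁ - τ₂) / τ₂) • (u T i - g (star.face T) i)) fun T i =>
      Submodule.smul_mem _ _ (Submodule.sub_mem _ (h.mem.2.1 T i) (h.mem.2.2.2 _ i).1)
  refine ⟨u + w, h.add_orthLower hwk hw fun T i x hx => ?_⟩
  rw [ev_sub, ev_add, hwF T i x hx, ev_smul, ev_sub]
  field_simp
  ring

theorem formBd_stabL_eq (h : SolvesPolyStep star k τ c ℓ r (L, u, p, g)) {v : M.VecField}
    (hv : v ∈ M.V k) (hvo : OrthLower k v) :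
    M.formBd (stabL star τ (M.traceV u - M.skelL g)) (M.traceV v) = ℓ v := by
  rw [← h.momentum v hv, momentumForm_apply, formV_comm, map_add, map_neg,
    hvo.formV_divL h.mem.1, hvo.formV_gradL h.mem.2.2.1, neg_zero, zero_add, zero_add]

theorem ev_eq_on_star (h : SolvesPolyStep star k τ c ℓ r (L, u, p, g)) (hτ : τ ≠ 0)
    (hℓ : M.VanishesOnTop k ℓ) (T : M.cells) (i : Fin 3) :
    ∀ x ∈ hull (star.face T), ev (u T i) x = ev (g (star.face T) i) x := by
  obtain ⟨w, hwk, hw, hwF⟩ := exists_orthLower_ev_eq star (k := k)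
    (v := fun T i => u T i - g (star.face T) i) fun T i =>
      Submodule.sub_mem _ (h.mem.2.1 T i) (h.mem.2.2.2 _ i).1
  have hself : M.formBd (stabL star τ (M.traceV u - M.skelL g)) (M.traceV u - M.skelL g) = 0 := by
    rw [← hℓ w hwk hw, ← h.formBd_stabL_eq hwk hw]
    exact formBd_stabL_congr_right fun T i x hx => (hwF T i x hx).symm
  intro x hx
  rw [← sub_eq_zero, ← ev_sub]
  exact ev_eq_zero_of_formBd_stabL_self_eq_zero hτ hself T i x hx

theorem vanishesOnTop_of_ne (hτ : τ₁ ≠ τ₂) (h₁ : SolvesPolyStep star k τ₁ c ℓ r (L₁, u, p₁, g₁))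
    (h₂ : SolvesPolyStep star k τ₂ c ℓ r (L₂, u, p₂, g₂))
    (hg : ∀ F : M.facets, ∀ x ∈ hull F, ∀ i, ev (g₁ F i) x = ev (g₂ F i) x) :
    M.VanishesOnTop k ℓ := by
  intro v hv hvo
  have htrace : M.formBd (stabL star τ₁ (M.traceV u - M.skelL g₁)) (M.traceV v) =
      M.formBd (stabL star τ₁ (M.traceV u - M.skelL g₂)) (M.traceV v) :=
    formBd_stabL_congr_left _ fun T i x hx => by
      simp only [Pi.sub_apply, ev_sub, skelL, LinearMap.coe_mk, AddHom.coe_mk, hg _ x hx]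
  have h₁v := htrace.symm.trans (h₁.formBd_stabL_eq hv hvo)
  have h₂v := h₂.formBd_stabL_eq hv hvo
  rw [formBd_stabL] at h₁v h₂v
  have hzero := sub_eq_zero.2 (h₁v.trans h₂v.symm)
  rw [← sub_mul, mul_eq_zero_iff_left (sub_ne_zero.2 hτ)] at hzero
  rw [← h₁v, hzero, mul_zero]

theorem compare (hτ₁ : 0 < τ₁) (hτ₂ : 0 < τ₂) (hc : 0 < c)
    (h₁ : SolvesPolyStep star k τ₁ c ℓ r (L₁, u₁, p₁, g₁))
    (h₂ : SolvesPolyStep star k τ₂ c ℓ r (L₂, u₂, p₂, g₂)) :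
    L₁ = L₂ ∧ p₁ = p₂ ∧
      (∀ F : M.facets, ∀ x ∈ hull F, ∀ i, ev (g₁ F i) x = ev (g₂ F i) x) ∧
      (u₁ = u₂ ↔ τ₁ = τ₂ ∨ M.VanishesOnTop k ℓ) := by
  obtain ⟨u', h'⟩ := h₁.exists_of_ne_zero hτ₂.ne'
  obtain ⟨hL, -, hp, hg⟩ := h'.unique hτ₂ hc h₂
  refine ⟨hL, hp, hg, ?_, ?_⟩
  · rintro rfl
    exact or_iff_not_imp_left.2 fun hτ => vanishesOnTop_of_ne hτ h₁ h₂ hg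
  · rintro (rfl | hℓ)
    · exact (h₁.unique hτ₁ hc h₂).2.1
    · have hsame : SolvesPolyStep star k τ₂ c ℓ r (L₁, u₁ + 0, p₁, g₁) :=
        h₁.add_orthLower (fun _ _ => Submodule.zero_mem _) (fun _ _ _ _ => by simp)
          fun T i x hx => by
            simp [ev_sub, h₁.ev_eq_on_star hτ₁.ne' hℓ T i x hx]
      rw [add_zero] at hsame
      exact (hsame.unique hτ₂ hc h₂).2.1

end SolvesPolyStep

theorem SolvesStep.compare {f : Pt → Pt} {pOld : M.ScalField} {lam₁ lam₂ : M.SkelField}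
    (hτ₁ : 0 < τ₁) (hτ₂ : 0 < τ₂) (hdt : 0 < dt)
    (h₁ : SolvesStep star k τ₁ dt f pOld L₁ u₁ p₁ lam₁)
    (h₂ : SolvesStep star k τ₂ dt f pOld L₂ u₂ p₂ lam₂) :
    (∀ F : M.facets, Set.EqOn (lam₁ F) (lam₂ F) (hull F)) ∧ p₁ = p₂ ∧ L₁ = L₂ ∧
      (u₁ = u₂ ↔ τ₁ = τ₂ ∨ M.NoTopDegree k f) := by
  obtain ⟨g₁, hg₁, hlam₁⟩ := exists_isRepresentedBy h₁.lam_mem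
  obtain ⟨g₂, hg₂, hlam₂⟩ := exists_isRepresentedBy h₂.lam_mem
  obtain ⟨hL, hp, hg, hu⟩ := ((hlam₁.solvesStep_iff h₁.lam_mem hg₁).1 h₁).compare hτ₁ hτ₂
    (one_div_pos.2 hdt) ((hlam₂.solvesStep_iff h₂.lam_mem hg₂).1 h₂)
  refine ⟨fun F x hx => funext fun i => ?_, hp, hL,
    hu.trans (or_congr_right noTopDegree_iff_vanishesOnTop.symm)⟩
  rw [hlam₁ F x hx, hlam₂ F x hx, hg F x hx]

theorem IsIteration.compare {f : Pt → Pt} {p₀ : Pt → ℝ} {L₁ L₂ : ℕ → M.MatField}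
    {u₁ u₂ : ℕ → M.VecField} {p₁ p₂ : ℕ → M.ScalField} {lam₁ lam₂ : ℕ → M.SkelField}
    (hτ₁ : 0 < τ₁) (hτ₂ : 0 < τ₂) (hdt : 0 < dt)
    (h₁ : IsIteration star k τ₁ dt f p₀ L₁ u₁ p₁ lam₁)
    (h₂ : IsIteration star k τ₂ dt f p₀ L₂ u₂ p₂ lam₂) {n : ℕ} (hn : 1 ≤ n) :
    (∀ F : M.facets, Set.EqOn (lam₁ n F) (lam₂ n F) (hull F)) ∧ p₁ n = p₂ n ∧ L₁ n = L₂ n ∧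
      (u₁ n = u₂ n ↔ τ₁ = τ₂ ∨ M.NoTopDegree k f) := by
  have hp (n : ℕ) : p₁ n = p₂ n := by
    induction n with
    | zero =>
      exact eq_of_innerQ_eq h₁.init_mem h₂.init_mem fun q hq =>
        (h₁.init_eq q hq).trans (h₂.init_eq q hq).symm
    | succ n ih => exact ((h₁.step n).compare hτ₁ hτ₂ hdt (ih ▸ h₂.step n)).2.1
  obtain ⟨m, rfl⟩ := Nat.exists_eq_add_of_le' hn
  exact (h₁.step m).compare hτ₁ hτ₂ hdt (hp m ▸ h₂.step m)

end ParameterDependence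

section Domain

theorem restrict_hull_le (hΩ : interior (closure Ω) = Ω) (T : M.cells) :
    volume.restrict (hull T) ≤ volume.restrict Ω := by
  have hsub : interior (hull T) ⊆ Ω := (interior_mono
    ((M.convexHull_subset_space (M.cell_mem_faces T)).trans M.space_eq.subset)).trans hΩ.subset
  have hae : (hull T : Set Pt) =ᵐ[volume] interior (hull T) :=
    (interior_ae_eq_of_null_frontier ((convex_convexHull ℝ _).addHaar_frontier _)).symm
  rw [Measure.restrict_congr_set hae]
  exact Measure.restrict_mono hsub le_rfl

theorem integrableOn_hull_of_memLp {E : Type*} [NormedAddCommGroup E] {φ : Pt → E}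
    (hφ : MemLp φ 2 (volume.restrict Ω)) (hΩ : interior (closure Ω) = Ω) (T : M.cells) :
    IntegrableOn φ (hull T) := by
  have : IsFiniteMeasure (volume.restrict (hull (T : Finset Pt))) :=
    isFiniteMeasure_restrict.2 (isCompact_hull _).measure_ne_top
  exact (hφ.mono_measure (restrict_hull_le hΩ T)).integrable one_le_two

theorem isCompact_closure_domain (M : Mesh Ω) : IsCompact (closure Ω) := by
  rw [← M.space_eq]
  exact M.finite_faces.isCompact_biUnion fun s _ => isCompact_hull s

theorem memLp_of_continuous (M : Mesh Ω) {E : Type*} [NormedAddCommGroup E] {φ : Pt → E}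
    (hφ : Continuous φ) (p : ENNReal) : MemLp φ p (volume.restrict Ω) := by
  have hcompact := M.isCompact_closure_domain
  obtain ⟨C, hC⟩ := hcompact.exists_bound_of_continuousOn hφ.continuousOn
  have : IsFiniteMeasure (volume.restrict (closure Ω)) :=
    isFiniteMeasure_restrict.2 hcompact.measure_ne_top
  have hclosure : MemLp φ p (volume.restrict (closure Ω)) :=
    .of_bound hφ.aestronglyMeasurable C
      ((ae_restrict_iff' isClosed_closure.measurableSet).2 (.of_forall hC))
  exact hclosure.mono_measure (Measure.restrict_mono subset_closure le_rfl)

theorem nonempty_cells (M : Mesh Ω) (hΩ : Ω.Nonempty) : Nonempty M.cells := by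
  obtain ⟨x, hx⟩ := hΩ.closure
  rw [← M.space_eq, Geometry.SimplicialComplex.mem_space_iff] at hx
  obtain ⟨s, hs, -⟩ := hx
  obtain ⟨T, hT, -, hcard⟩ := M.pure s hs
  exact ⟨T, Finset.mem_filter.2 ⟨by simpa using hT, hcard⟩⟩

theorem exists_ne_zero_orthogonal (M : Mesh Ω) (T : M.cells) (k : ℕ) :
    ∃ w ∈ P k, w ≠ 0 ∧ ∀ s : Poly, s.totalDegree < k → cellInt T (w * s) = 0 := by
  have hT := M.isTetrahedron T
  obtain ⟨b, hb⟩ : (T : Finset Pt).Nonempty := Finset.card_pos.1 (by simp [hT.card_eq_four])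
  obtain ⟨w, hw, hwF, hworth⟩ := hT.exists_orthogonal_lift hb (g := 1) (k := k)
    (mem_P.2 (by simp))
  refine ⟨w, hw, ?_, hworth⟩
  rintro rfl
  obtain ⟨y, hy⟩ := hT.erase_nonempty hb
  have hone := hwF y (subset_convexHull ℝ _ hy)
  rw [ev_zero, ev_one] at hone
  exact zero_ne_one hone

theorem exists_not_noTopDegree (M : Mesh Ω) (hΩ : Ω.Nonempty) (k : ℕ) :
    ∃ f : Pt → Pt, MemLp f 2 (volume.restrict Ω) ∧ ¬ M.NoTopDegree k f := by
  obtain ⟨T⟩ := M.nonempty_cells hΩ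
  obtain ⟨w, hw, hw₀, hworth⟩ := M.exists_ne_zero_orthogonal T k
  have hcont : Continuous fun x : Pt => (WithLp.toLp 2 fun _ => ev w x : Pt) := by
    have := continuous_ev w
    fun_prop
  refine ⟨_, M.memLp_of_continuous hcont 2, fun h => hw₀ ?_⟩
  have hself := h T (fun _ => w) (fun _ => hw) fun s hs => by
    rw [cellInner_ev]
    exact Finset.sum_eq_zero fun i _ => hworth _ (hs i)
  refine (M.isTetrahedron T).eq_zero_of_cellInt_mul_self_eq_zero ?_
  have hsum := (cellInner_ev (T : Finset Pt) (fun _ : Fin 3 => w) fun _ => w).symm.trans hself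
  simpa using hsum

end Domain

end Mesh

end StokesHDG

theorem mainTheorem4 {Ω : Set StokesHDG.Pt} (hΩ_ne : Ω.Nonempty)
    (hΩ_reg : interior (closure Ω) = Ω) (M : StokesHDG.Mesh Ω) (star : M.StarChoice)
    (k : ℕ) (dt : ℝ) (hdt : 0 < dt) :
    (∀ (f : StokesHDG.Pt → StokesHDG.Pt) (p₀ : StokesHDG.Pt → ℝ),
      MemLp f 2 (volume.restrict Ω) → MemLp p₀ 2 (volume.restrict Ω) →
      -- the iterates exist for every positive value of the stabilization parameter
      (∀ τ : ℝ, 0 < τ → ∃ L u p lam,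
        StokesHDG.Mesh.IsIteration star k τ dt f p₀ L u p lam) ∧
      ∀ τ₁ τ₂ : ℝ, 0 < τ₁ → 0 < τ₂ → ∀ L₁ u₁ p₁ lam₁ L₂ u₂ p₂ lam₂,
        StokesHDG.Mesh.IsIteration star k τ₁ dt f p₀ L₁ u₁ p₁ lam₁ →
        StokesHDG.Mesh.IsIteration star k τ₂ dt f p₀ L₂ u₂ p₂ lam₂ →
        ∀ n : ℕ, 1 ≤ n →
          -- the skeleton function, the pressure and the gradient do not depend on the parameter
          (∀ F, Set.EqOn (lam₁ n F) (lam₂ n F) (StokesHDG.hull F)) ∧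
          p₁ n = p₂ n ∧ L₁ n = L₂ n ∧
          -- the velocity is unique, and depends on the parameter exactly if `f` has a component
          -- of top degree on some cell
          (u₁ n = u₂ n ↔ τ₁ = τ₂ ∨ M.NoTopDegree k f)) ∧
    -- such right-hand sides exist
    (∃ f : StokesHDG.Pt → StokesHDG.Pt,
      MemLp f 2 (volume.restrict Ω) ∧ ¬ M.NoTopDegree k f) := by
  refine ⟨fun f p₀ hf hp₀ => ⟨fun τ hτ => ?_, fun τ₁ τ₂ hτ₁ hτ₂ L₁ u₁ p₁ lam₁ L₂ u₂ p₂ lam₂ h₁ h₂ n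
    hn => h₁.compare hτ₁ hτ₂ hdt h₂ hn⟩, M.exists_not_noTopDegree hΩ_ne k⟩
  exact StokesHDG.Mesh.exists_isIteration star k hτ hdt
    (StokesHDG.Mesh.integrableOn_hull_of_memLp hf hΩ_reg)
    (StokesHDG.Mesh.integrableOn_hull_of_memLp hp₀ hΩ_reg)
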